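/- Let $G=(V,E)$ be a finite simple graph. For a function $f:V\to\mathbb{N}$, an $f$-assignment is a map $L$ assigning to each vertex $v$ a set $L(v)\subset\mathbb{N}$ of colors with $|L(v)|=f(v)$; $f$ is a choice function for $G$ if for every $f$-assignment $L$ there is a proper coloring $c$ of $G$ with $c(v)\in L(v)$ for all $v\in V$. The sum choice number $\chi_{SC}(G)$ is the minimum of $\sum_{v\in V}f(v)$ over all choice functions $f$ for $G$, and $G$ is called sc-greedy if $\chi_{SC}(G)=|V|+|E|$. For an integer $k\ge 0$, the broken wheel (fan) $BW_k$ is the graph on $k+1$ vertices $v_0,v_1,\dots,v_k$ formed from the path $v_1v_2\cdots v_k$ by making $v_0$ adjacent to each of $v_1,\dots,v_k$. The wheel $W_k$ is the graph on $v_0,v_1,\dots,v_k$ formed in the same way from the cycle $v_1v_2\cdots v_kv_1$. For $k\ge 3$, thus, $BW_k=W_k-v_1v_k$; for $k\le 2$ the "cycle" is understood without loops or multiple edges, so that $W_k=BW_k$ is the complete graph on $k+1$ vertices. **Theorem.** 1. If $k\le 9$, then $BW_k$ is sc-greedy. 2. If $k\ge 10$, then $BW_k$ is not sc-greedy. 3.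 If $k\le 3$, then $W_k$ is sc-greedy. 4. If $k=4$ or $k\ge 11$, then $W_k$ is not sc-greedy. -/

import Mathlib

namespace SumList

variable {V : Type*}

/-- `L` assigns to every vertex a list of exactly `f v` colors; colors are natural numbers. -/
def IsAssignment (f : V → ℕ) (L : V → Finset ℕ) : Prop :=
  ∀ v, (L v).card = f v

/-- `G` has a proper coloring in which every vertex gets a color of its list. -/
def ListColorable (G : SimpleGraph V) (L : V → Finset ℕ) : Prop :=
  ∃ C : G.Coloring ℕ, ∀ v, C v ∈ L v

/-- `G` is `f`-choosable, that is, `f` is a choice function for `G`. -/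
def IsChoiceFunction (G : SimpleGraph V) (f : V → ℕ) : Prop :=
  ∀ L : V → Finset ℕ, IsAssignment f L → ListColorable G L

/-- The size of a size function. -/
def size [Fintype V] (f : V → ℕ) : ℕ := ∑ v, f v

/-- The sum choice number: the minimum size of a choice function. The minimum is over a nonempty
set of natural numbers, see `exists_isChoiceFunction`. -/
noncomputable def sumChoiceNumber [Fintype V] (G : SimpleGraph V) : ℕ :=
  sInf {m | ∃ f : V → ℕ, IsChoiceFunction G f ∧ size f = m}

/-- The greedy bound: number of vertices plus number of edges. -/
noncomputable def greedyBound [Fintype V] (G : SimpleGraph V) : ℕ :=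
  Fintype.card V + G.edgeSet.ncard

/-- `G` is sc-greedy if its sum choice number equals the greedy bound. -/
def ScGreedy [Fintype V] (G : SimpleGraph V) : Prop :=
  sumChoiceNumber G = greedyBound G

/-- Lists of size `|V|` always suffice, so the sum choice number is a genuine minimum. -/
theorem exists_isChoiceFunction [Fintype V] (G : SimpleGraph V) :
    ∃ f : V → ℕ, IsChoiceFunction G f := by
  classical
  refine ⟨fun _ => Fintype.card V, fun L hL => ?_⟩
  obtain ⟨g, hg, hgL⟩ := (Finset.all_card_le_biUnion_card_iff_exists_injective L).1 (by
    intro s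
    rcases s.eq_empty_or_nonempty with rfl | ⟨v, hv⟩
    · simp
    · calc s.card ≤ Fintype.card V := Finset.card_le_univ s
        _ = (L v).card := (hL v).symm
        _ ≤ (s.biUnion L).card := Finset.card_le_card (Finset.subset_biUnion_of_mem L hv))
  exact ⟨SimpleGraph.Coloring.mk g (fun h e => h.ne (hg e)), hgL⟩

/-- The wheel `W_k` on the vertices `0, 1, …, k`: the cycle `1, 2, …, k, 1` together with the
hub `0`, adjacent to every other vertex. (`fromRel` symmetrizes the relation and drops loops.) -/
def wheel (k : ℕ) : SimpleGraph (Fin (k + 1)) :=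
  SimpleGraph.fromRel fun i j =>
    i.val = 0 ∨ i.val + 1 = j.val ∨ (i.val = 1 ∧ j.val = k)

/-- The broken wheel (fan) `BW_k` on the vertices `0, 1, …, k`: the path `1, 2, …, k` together
with the hub `0`, adjacent to every other vertex. -/
def brokenWheel (k : ℕ) : SimpleGraph (Fin (k + 1)) :=
  SimpleGraph.fromRel fun i j => i.val = 0 ∨ i.val + 1 = j.val

/-- For `k ≥ 3` the broken wheel is the wheel without the edge between the vertices `1` and `k`. -/
theorem brokenWheel_eq_deleteEdges {k : ℕ} (hk : 3 ≤ k) :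
    brokenWheel k =
      (wheel k).deleteEdges {s((⟨1, by omega⟩ : Fin (k + 1)), Fin.last k)} := by
  ext i j
  simp only [brokenWheel, wheel, SimpleGraph.deleteEdges_adj, SimpleGraph.fromRel_adj,
    Set.mem_singleton_iff, Sym2.eq_iff, Fin.ext_iff, Fin.val_last, ne_eq]
  omega

end SumList

/-!
Fix lists on the rim of a fan and call a color *blocked* if removing it from all rim lists makes
the rim path uncolorable. A size function `f` is a choice function for `BW_k` exactly if no choice
of rim lists of the sizes `f v₁, …, f v_k` has `f v₀` or more blocked colors. The greedy bounds
are `3k` for the fan (`k ≥ 1`) and `3k + 1` for the wheel (`k ≥ 3`), and they are always upper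
bounds for the sum choice number; see `greedyBound_brokenWheel`, `greedyBound_wheel` and
`sumChoiceNumber_le_greedyBound`.

*Short fans.* It has to be shown that rim sizes `s` admit lists with at least `3k - 1 - ∑ s`
blocked colors. Blocked colors of disjoint subpaths with disjoint palettes add up
(`Blocks.append`), which handles sizes `≥ 4`. A list of size `1` blocks its own color, and this
color can be added to both neighboring lists for free (`Blocks.one`). What remains are sequences
of twos and threes of length at most `9`, and these are concatenations of the blocks of a short
table (`exists_blocks_two_three`).

*Long fans and wheels.* With rim sizes `2, 3, 2, 2, 2, 2, 2, 2, 3, 2` at most six colors are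
blocked (`exists_path_coloring`), so that a hub list of size `7` suffices. This saves one compared
with the greedy bound, and further vertices are colored greedily (`listColorable_of_partial`). To
bound the number of blocked colors, cut the path in the middle. When a color `z` is removed, each
half is uncolorable (`z` is *dead*), or its vertex at the cut is forced to a single color, or that
vertex has a choice; `z` is blocked exactly if it is dead in one half or forces the same color on
both sides of the cut. Following the numbers of dead and of forcing colors along one half
(`Fits.exists_follows`) gives inequalities between them (`HalfBound`) from which
`HalfBound.card_ne_seven` follows.

*The wheel `W_4`.* The sizes `3` for the hub and `2, 2, 2, 3` on the rim suffice
(`exists_cycle_coloring`). The wheel `W_3` is a complete graph, where nested lists give the lower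
bound, and shorter wheels are fans. -/

namespace SumList
open Finset

/-! ### Counting the elements of a finite set with a property -/

/-- The number of elements of `S` with the property `P`. -/
noncomputable def count (S : Finset ℕ) (P : ℕ → Prop) : ℕ := by
  classical exact ∑ z ∈ S, if P z then 1 else 0

theorem count_eq_card (S : Finset ℕ) (P : ℕ → Prop) [DecidablePred P] :
    count S P = #{z ∈ S | P z} := by
  classical
  rw [count, Finset.card_filter]
  exact Finset.sum_congr rfl fun z _ => by congr

theorem count_and_eq_le_one (S : Finset ℕ) (a : ℕ) (P : ℕ → Prop) :
    count S (fun z => z = a ∧ P z) ≤ 1 := by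
  classical
  rw [count_eq_card, Finset.card_le_one]
  simp only [Finset.mem_filter]
  rintro x ⟨_, rfl, _⟩ y ⟨_, rfl, _⟩
  rfl

theorem exists_of_one_le_count {S : Finset ℕ} {P : ℕ → Prop} (h : 1 ≤ count S P) :
    ∃ z ∈ S, P z := by
  classical
  rw [count_eq_card, Finset.one_le_card] at h
  obtain ⟨z, hz⟩ := h
  exact ⟨z, by simpa using hz⟩

theorem count_mono {S : Finset ℕ} {P Q : ℕ → Prop} (h : ∀ z ∈ S, P z → Q z) :
    count S P ≤ count S Q := by
  classical
  simp only [count]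
  refine Finset.sum_le_sum fun z hz => ?_
  have := h z hz
  split_ifs <;> simp_all

theorem count_le_add {S : Finset ℕ} {P Q T : ℕ → Prop} (h : ∀ z ∈ S, P z → Q z ∨ T z) :
    count S P ≤ count S Q + count S T := by
  classical
  simp only [count, ← Finset.sum_add_distrib]
  refine Finset.sum_le_sum fun z hz => ?_
  have := h z hz
  split_ifs <;> simp_all

theorem add_count_le {S : Finset ℕ} {P Q T : ℕ → Prop}
    (h : ∀ z ∈ S, (P z → T z) ∧ (Q z → T z) ∧ ¬ (P z ∧ Q z)) :
    count S P + count S Q ≤ count S T := by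
  classical
  simp only [count, ← Finset.sum_add_distrib]
  refine Finset.sum_le_sum fun z hz => ?_
  have := h z hz
  split_ifs <;> simp_all

theorem add_count_le_add {S : Finset ℕ} {P Q T U : ℕ → Prop}
    (h : ∀ z ∈ S, (P z → T z ∨ U z) ∧ (Q z → T z ∨ U z) ∧ ¬ (P z ∧ Q z)) :
    count S P + count S Q ≤ count S T + count S U := by
  classical
  simp only [count, ← Finset.sum_add_distrib]
  refine Finset.sum_le_sum fun z hz => ?_
  have := h z hz
  split_ifs <;> simp_all

/-! ### Removing a color from the lists on a path -/

/-- One step along a path.  If `R z` is the set of colors that the last vertex can receive when the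
color `z` is not used, then `step R L z` is the corresponding set for a new last vertex with
list `L`. -/
def step (R : ℕ → Finset ℕ) (L : Finset ℕ) (z : ℕ) : Finset ℕ :=
  {q ∈ L | q ≠ z ∧ ∃ p ∈ R z, p ≠ q}

theorem mem_step {R : ℕ → Finset ℕ} {L : Finset ℕ} {z q : ℕ} :
    q ∈ step R L z ↔ q ∈ L ∧ q ≠ z ∧ ∃ p ∈ R z, p ≠ q := by
  simp [step]

/-- `R` describes the colors available at a vertex with list `{a, b}`. -/
structure Fits (R : ℕ → Finset ℕ) (a b : ℕ) : Prop where
  ne : a ≠ b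
  sub : ∀ z q, q ∈ R z → q = a ∨ q = b
  notMem : ∀ z, z ∉ R z

namespace Fits

variable {R : ℕ → Finset ℕ} {a b : ℕ}

theorem symm (h : Fits R a b) : Fits R b a :=
  ⟨h.ne.symm, fun z q hq => (h.sub z q hq).symm, h.notMem⟩

theorem eq_empty (h : Fits R a b) (z : ℕ) : R z = ∅ ↔ a ∉ R z ∧ b ∉ R z := by
  constructor
  · intro e; simp [e]
  · rintro ⟨h1, h2⟩
    refine Finset.eq_empty_of_forall_notMem fun q hq => ?_
    rcases h.sub z q hq with rfl | rfl <;> contradiction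

theorem eq_left (h : Fits R a b) (z : ℕ) : R z = {a} ↔ a ∈ R z ∧ b ∉ R z := by
  have := h.ne
  constructor
  · intro e; simp [e, this.symm]
  · rintro ⟨h1, h2⟩
    refine Finset.eq_singleton_iff_unique_mem.2 ⟨h1, fun q hq => ?_⟩
    rcases h.sub z q hq with rfl | rfl
    · rfl
    · contradiction

theorem eq_right (h : Fits R a b) (z : ℕ) : R z = {b} ↔ b ∈ R z ∧ a ∉ R z :=
  h.symm.eq_left z

theorem mem_step_iff (h : Fits R a b) {L : Finset ℕ} {z q : ℕ} :
    q ∈ step R L z ↔ q ∈ L ∧ q ≠ z ∧ (a ∈ R z ∧ a ≠ q ∨ b ∈ R z ∧ b ≠ q) := by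
  rw [mem_step]
  refine and_congr_right fun _ => and_congr_right fun _ => ⟨?_, ?_⟩
  · rintro ⟨p, hp, hpq⟩
    rcases h.sub z p hp with rfl | rfl
    · exact .inl ⟨hp, hpq⟩
    · exact .inr ⟨hp, hpq⟩
  · rintro (⟨h1, h2⟩ | ⟨h1, h2⟩)
    exacts [⟨_, h1, h2⟩, ⟨_, h1, h2⟩]

end Fits

theorem fits_step (R : ℕ → Finset ℕ) {c d : ℕ} (hcd : c ≠ d) : Fits (step R {c, d}) c d :=
  ⟨hcd, fun z q hq => by simpa using (mem_step.1 hq).1, fun z hz => (mem_step.1 hz).2.1 rfl⟩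

/-! ### Dead and forcing colors -/

/-- The number of colors of `S` without which the path cannot be colored. -/
noncomputable def dead (S : Finset ℕ) (R : ℕ → Finset ℕ) : ℕ := count S (fun z => R z = ∅)

/-- The number of colors of `S` whose removal forces the color `p` on the last vertex. -/
noncomputable def forcing (S : Finset ℕ) (R : ℕ → Finset ℕ) (p : ℕ) : ℕ :=
  count S (fun z => R z = {p})

/-- `1` if `a` is a color of `S` without which the path cannot be colored, otherwise `0`. -/
noncomputable def deadAt (S : Finset ℕ) (R : ℕ → Finset ℕ) (a : ℕ) : ℕ :=
  count S (fun z => z = a ∧ R z = ∅)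

/-- `1` if `a` is a color of `S` whose removal forces `b` on the last vertex, otherwise `0`. -/
noncomputable def forcingAt (S : Finset ℕ) (R : ℕ → Finset ℕ) (a b : ℕ) : ℕ :=
  count S (fun z => z = a ∧ R z = {b})

variable {S : Finset ℕ} {R : ℕ → Finset ℕ} {a b d : ℕ}

/-- The three restricted values of `R z` exclude each other. -/
theorem Fits.exclusive (h : Fits R a b) (z : ℕ) :
    ¬ (R z = ∅ ∧ R z = {a}) ∧ ¬ (R z = ∅ ∧ R z = {b}) ∧ ¬ (R z = {a} ∧ R z = {b}) ∧
      ¬ R a = {a} ∧ ¬ R b = {b} := by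
  have ha := h.notMem a
  have hb := h.notMem b
  simp only [h.eq_empty, h.eq_left, h.eq_right]
  tauto

/-- The relations between the counts at a vertex with list `{a, b}`. -/
theorem Fits.basic (S : Finset ℕ) (h : Fits R a b) :
    deadAt S R a + forcingAt S R a b ≤ 1 ∧ deadAt S R b + forcingAt S R b a ≤ 1 ∧
    forcingAt S R b a ≤ forcing S R a ∧ forcingAt S R a b ≤ forcing S R b ∧
    deadAt S R a + deadAt S R b ≤ dead S R := by
  have hne := h.ne
  refine ⟨?_, ?_, ?_, ?_, ?_⟩
  · refine (add_count_le (T := fun z => z = a ∧ True) fun z _ => ?_).trans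
      (count_and_eq_le_one S a _)
    grind [h.exclusive z]
  · refine (add_count_le (T := fun z => z = b ∧ True) fun z _ => ?_).trans
      (count_and_eq_le_one S b _)
    grind [h.exclusive z]
  · exact count_mono fun z _ hz => hz.2
  · exact count_mono fun z _ hz => hz.2
  · refine add_count_le fun z _ => ?_
    grind

theorem Fits.step_same_iff (h : Fits R a b) (z : ℕ) :
    (step R {a, b} z = ∅ ↔ R z = ∅ ∨ z = a ∧ R z = {b} ∨ z = b ∧ R z = {a}) ∧
    (step R {a, b} z = {a} ↔ z ≠ a ∧ R z = {b}) ∧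
    (step R {a, b} z = {b} ↔ z ≠ b ∧ R z = {a}) := by
  have h' := fits_step R h.ne
  have hne := h.ne
  have hm := h.notMem z
  rw [h'.eq_empty, h'.eq_left, h'.eq_right, h.mem_step_iff, h.mem_step_iff, h.eq_empty,
    h.eq_left, h.eq_right]
  by_cases ha : z = a
  · subst ha; simp; grind
  by_cases hb : z = b
  · subst hb; simp; grind
  simp; grind

/-- The change of the counts when the list `{a, b}` is repeated. -/
theorem Fits.step_same (S : Finset ℕ) (h : Fits R a b) :
    dead S (step R {a, b}) ≤ dead S R + forcingAt S R a b + forcingAt S R b a ∧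
    forcing S (step R {a, b}) a + forcingAt S R a b ≤ forcing S R b ∧
    forcing S (step R {a, b}) b + forcingAt S R b a ≤ forcing S R a ∧
    forcingAt S (step R {a, b}) a b ≤ 0 ∧ forcingAt S (step R {a, b}) b a ≤ 0 ∧
    deadAt S (step R {a, b}) a = deadAt S R a + forcingAt S R a b ∧
    deadAt S (step R {a, b}) b = deadAt S R b + forcingAt S R b a := by
  have hne := h.ne
  have hfalse : count S (fun _ => False) = 0 := by simp [count]
  have key := h.step_same_iff
  refine ⟨?_, ?_, ?_, ?_, ?_, le_antisymm ?_ ?_, le_antisymm ?_ ?_⟩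
  · refine (count_le_add (T := fun z => z = b ∧ R z = {a})
      (Q := fun z => R z = ∅ ∨ z = a ∧ R z = {b}) fun z _ => ?_).trans
      (Nat.add_le_add_right (count_le_add fun z _ => id) _)
    grind [h.exclusive z, key z]
  · exact add_count_le fun z _ => by grind [h.exclusive z, key z]
  · exact add_count_le fun z _ => by grind [h.exclusive z, key z]
  · exact hfalse ▸ count_mono fun z _ => by grind [h.exclusive z, key z]
  · exact hfalse ▸ count_mono fun z _ => by grind [h.exclusive z, key z]
  · exact count_le_add fun z _ => by grind [h.exclusive z, key z]
  · exact add_count_le fun z _ => by grind [h.exclusive z, key z]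
  · exact count_le_add fun z _ => by grind [h.exclusive z, key z]
  · exact add_count_le fun z _ => by grind [h.exclusive z, key z]

theorem Fits.step_share_iff (h : Fits R a b) (hda : d ≠ a) (hdb : d ≠ b) (z : ℕ) :
    (step R {a, d} z = ∅ ↔ R z = ∅ ∨ z = d ∧ R z = {a}) ∧
    (step R {a, d} z = {a} ↔ z = d ∧ R z ≠ ∅ ∧ R z ≠ {a}) ∧
    (step R {a, d} z = {d} ↔ z = a ∧ R z ≠ ∅ ∨ z ≠ d ∧ R z = {a}) := by
  have h' := fits_step R hda.symm
  have hne := h.ne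
  have hm := h.notMem z
  rw [Ne, Ne, h'.eq_empty, h'.eq_left, h'.eq_right, h.mem_step_iff, h.mem_step_iff, h.eq_empty,
    h.eq_left]
  by_cases ha : z = a
  · subst ha; simp; grind
  by_cases hb : z = d
  · subst hb; simp; grind
  simp; grind

/-- The change of the counts when the list `{a, b}` is followed by a list `{a, d}` with `d ≠ b`. -/
theorem Fits.step_share (S : Finset ℕ) (h : Fits R a b) (hda : d ≠ a) (hdb : d ≠ b) :
    dead S (step R {a, d}) ≤ dead S R + forcingAt S R d a ∧
    deadAt S (step R {a, d}) a = deadAt S R a ∧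
    deadAt S (step R {a, d}) d = deadAt S R d + forcingAt S R d a ∧
    deadAt S R d + deadAt S R a + deadAt S R b ≤ dead S R ∧
    forcing S (step R {a, d}) a ≤ forcingAt S (step R {a, d}) d a ∧
    forcing S (step R {a, d}) d + forcingAt S R d a ≤ forcing S R a + forcingAt S R a b ∧
    forcingAt S (step R {a, d}) a d = forcingAt S R a b ∧
    forcingAt S R d a + forcingAt S R b a ≤ forcing S R a := by
  have hne := h.ne
  have key := h.step_share_iff hda hdb
  have ex := h.exclusive
  have hR : ∀ z, z = a → R z ≠ ∅ → R z = {b} := by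
    rintro z rfl hz
    have := h.notMem z
    rw [Ne, h.eq_empty] at hz
    rw [h.eq_right]
    tauto
  refine ⟨?_, le_antisymm ?_ ?_, le_antisymm ?_ ?_, ?_, ?_, ?_, le_antisymm ?_ ?_, ?_⟩
  · exact count_le_add fun z _ => by grind [ex z, key z]
  · exact count_mono fun z _ => by grind [ex z, key z]
  · exact count_mono fun z _ => by grind [ex z, key z]
  · exact count_le_add fun z _ => by grind [ex z, key z]
  · exact add_count_le fun z _ => by grind [ex z, key z]
  · refine (Nat.add_le_add_right (add_count_le
      (T := fun z => (z = d ∨ z = a) ∧ R z = ∅) fun z _ => ?_) _).trans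
      (add_count_le fun z _ => ?_) <;> grind
  · exact count_mono fun z _ => by grind [ex z, key z]
  · exact add_count_le_add fun z _ => by grind [ex z, key z, hR z]
  · exact count_mono fun z _ => by grind [ex z, key z, hR z]
  · exact count_mono fun z _ => by grind [ex z, key z, hR z]
  · exact add_count_le fun z _ => by grind [ex z, key z]

/-- The change of the counts when the list `{a, b}` is followed by a disjoint list `{c, d}`. -/
theorem Fits.step_disjoint {c : ℕ} (S : Finset ℕ) (h : Fits R a b) (hcd : c ≠ d)
    (hca : c ≠ a) (hcb : c ≠ b) (hda : d ≠ a) (hdb : d ≠ b) :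
    dead S (step R {c, d}) ≤ dead S R ∧
    forcing S (step R {c, d}) c ≤ forcingAt S (step R {c, d}) d c ∧
    forcing S (step R {c, d}) d ≤ forcingAt S (step R {c, d}) c d := by
  have h' := fits_step R hcd
  have hne := h.ne
  refine ⟨count_mono fun z _ => ?_, count_mono fun z _ => ?_, count_mono fun z _ => ?_⟩
  · rw [h'.eq_empty, h.eq_empty, h.mem_step_iff, h.mem_step_iff]
    grind
  · rw [h'.eq_left, h.mem_step_iff, h.mem_step_iff]
    grind
  · rw [h'.eq_right, h.mem_step_iff, h.mem_step_iff]
    grind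

/-- The possible changes of the counts along an edge of the path, when the list `{a, b}` is followed
by `{c, d}` and the colors are named suitably: the lists are equal, they share only `c = a`, they
share only `c = b`, or they are disjoint. -/
def Follows (S : Finset ℕ) (R : ℕ → Finset ℕ) (a b : ℕ) (R' : ℕ → Finset ℕ) (c d : ℕ) : Prop :=
  (dead S R' ≤ dead S R + forcingAt S R a b + forcingAt S R b a ∧
    forcing S R' c + forcingAt S R a b ≤ forcing S R b ∧
    forcing S R' d + forcingAt S R b a ≤ forcing S R a ∧
    forcingAt S R' c d ≤ 0 ∧ forcingAt S R' d c ≤ 0 ∧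
    deadAt S R' c = deadAt S R a + forcingAt S R a b ∧
    deadAt S R' d = deadAt S R b + forcingAt S R b a) ∨
  (dead S R' ≤ dead S R + forcingAt S R d a ∧
    deadAt S R' c = deadAt S R a ∧
    deadAt S R' d = deadAt S R d + forcingAt S R d a ∧
    deadAt S R d + deadAt S R a + deadAt S R b ≤ dead S R ∧
    forcing S R' c ≤ forcingAt S R' d c ∧
    forcing S R' d + forcingAt S R d a ≤ forcing S R a + forcingAt S R a b ∧
    forcingAt S R' c d = forcingAt S R a b ∧
    forcingAt S R d a + forcingAt S R b a ≤ forcing S R a) ∨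
  (dead S R' ≤ dead S R + forcingAt S R d b ∧
    deadAt S R' c = deadAt S R b ∧
    deadAt S R' d = deadAt S R d + forcingAt S R d b ∧
    deadAt S R d + deadAt S R b + deadAt S R a ≤ dead S R ∧
    forcing S R' c ≤ forcingAt S R' d c ∧
    forcing S R' d + forcingAt S R d b ≤ forcing S R b + forcingAt S R b a ∧
    forcingAt S R' c d = forcingAt S R b a ∧
    forcingAt S R d b + forcingAt S R a b ≤ forcing S R b) ∨
  (dead S R' ≤ dead S R ∧
    forcing S R' c ≤ forcingAt S R' d c ∧
    forcing S R' d ≤ forcingAt S R' c d)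

/-- Whatever list of size two comes next, its colors can be named so that `Follows` holds. -/
theorem Fits.exists_follows (S : Finset ℕ) (h : Fits R a b) {L : Finset ℕ} (hL : #L = 2) :
    ∃ c d, L = {c, d} ∧ Fits (step R L) c d ∧ Follows S R a b (step R L) c d := by
  obtain ⟨c, d, hcd, rfl⟩ := Finset.card_eq_two.1 hL
  by_cases hca : c = a
  · subst hca
    refine ⟨c, d, rfl, fits_step R hcd, ?_⟩
    by_cases hdb : d = b
    · subst hdb
      exact .inl (h.step_same S)
    · exact .inr (.inl (h.step_share S hcd.symm hdb))
  by_cases hcb : c = b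
  · subst hcb
    by_cases hda : d = a
    · subst hda
      rw [Finset.pair_comm]
      exact ⟨d, c, rfl, fits_step R hcd.symm, .inl (h.step_same S)⟩
    · exact ⟨c, d, rfl, fits_step R hcd, .inr (.inr (.inl (h.symm.step_share S hcd.symm hda)))⟩
  by_cases hda : d = a
  · subst hda
    rw [Finset.pair_comm]
    exact ⟨d, c, rfl, fits_step R hcd.symm, .inr (.inl (h.step_share S hcd hcb))⟩
  by_cases hdb : d = b
  · subst hdb
    rw [Finset.pair_comm]
    exact ⟨d, c, rfl, fits_step R hcd.symm, .inr (.inr (.inl (h.symm.step_share S hcd hca)))⟩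
  exact ⟨c, d, rfl, fits_step R hcd, .inr (.inr (.inr (h.step_disjoint S hcd hca hcb hda hdb)))⟩

/-! ### The path with list sizes `2, 3, 2, 2, 2, 2, 2, 2, 3, 2` -/

/-- Along a path with lists of sizes `2`, `3`, only the two colors `x`, `y` of the first list can be
removed with an effect on the next vertex, and both removals forbid the same color `e` there. -/
theorem exists_mem_step_two_three {x y : ℕ} (hxy : x ≠ y) {L₂ L₃ : Finset ℕ} (h₂ : #L₂ = 3) :
    ∃ e, e ≠ x ∧ e ≠ y ∧ ∀ z q, q ∈ step (step ({x, y} : Finset ℕ).erase L₂) L₃ z ↔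
      q ∈ L₃ ∧ q ≠ z ∧ ¬ ((z = x ∨ z = y) ∧ q = e) := by
  have hR : ∀ z q, q ∈ step (step ({x, y} : Finset ℕ).erase L₂) L₃ z ↔ q ∈ L₃ ∧ q ≠ z ∧
      ∃ p ∈ L₂, p ≠ z ∧ (x ≠ z ∧ x ≠ p ∨ y ≠ z ∧ y ≠ p) ∧ p ≠ q := by
    intro z q
    simp only [mem_step, Finset.mem_erase, Finset.mem_insert, Finset.mem_singleton]
    refine and_congr_right fun _ => and_congr_right fun _ => exists_congr fun p => ?_
    rw [and_assoc, and_assoc]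
    refine and_congr_right fun _ => and_congr_right fun _ => and_congr_left fun _ => ?_
    constructor
    · rintro ⟨r, ⟨h1, rfl | rfl⟩, h2⟩ <;> tauto
    · rintro (⟨h1, h2⟩ | ⟨h1, h2⟩)
      exacts [⟨x, ⟨h1, .inl rfl⟩, h2⟩, ⟨y, ⟨h1, .inr rfl⟩, h2⟩]
  by_cases hx : x ∈ L₂ ∧ y ∈ L₂
  · obtain ⟨e, he⟩ : ∃ e, (L₂.erase x).erase y = {e} := by
      rw [← Finset.card_eq_one, Finset.card_erase_of_mem, Finset.card_erase_of_mem hx.1, h₂]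
      exact Finset.mem_erase.2 ⟨hxy.symm, hx.2⟩
    have hm : ∀ p, p ∈ L₂ ↔ p = x ∨ p = y ∨ p = e := by
      intro p
      have := Finset.ext_iff.1 he p
      simp only [Finset.mem_erase, Finset.mem_singleton] at this
      grind
    have he' := Finset.ext_iff.1 he e
    simp only [Finset.mem_erase, Finset.mem_singleton] at he'
    refine ⟨e, by tauto, by tauto, fun z q => ?_⟩
    rw [hR]
    refine and_congr_right fun _ => and_congr_right fun hq => ?_
    simp only [hm, exists_eq_or_imp, exists_eq_left]
    grind
  · obtain ⟨e, he⟩ := Infinite.exists_notMem_finset (insert x (insert y L₃))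
    simp only [Finset.mem_insert, not_or] at he
    refine ⟨e, he.1, he.2.1, fun z q => ?_⟩
    rw [hR]
    refine and_congr_right fun hq3 => and_congr_right fun hq => ?_
    have hqe : q ≠ e := by rintro rfl; exact he.2.2 hq3
    obtain ⟨u, v, w, huv, huw, hvw, rfl⟩ := Finset.card_eq_three.1 h₂
    simp only [Finset.mem_insert, Finset.mem_singleton] at hx
    simp only [Finset.mem_insert, Finset.mem_singleton, exists_eq_or_imp, exists_eq_left, hqe,
      and_false, not_false_eq_true, iff_true]
    by_cases hzx : z = x
    · subst hzx; grind
    by_cases hzy : z = y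
    · subst hzy; grind
    grind

/-- The counts at the third vertex of a path with lists of sizes `2`, `3`, `2`. The color `a` is
the one that both colors of the first list may forbid at the third vertex, so that these two
colors either force `b` there or, if one of them is `b`, make the path uncolorable. -/
theorem exists_fits_two_three_two (S : Finset ℕ) {L₁ L₂ L₃ : Finset ℕ} (h₁ : #L₁ = 2)
    (h₂ : #L₂ = 3) (h₃ : #L₃ = 2) :
    ∃ a b, Fits (step (step L₁.erase L₂) L₃) a b ∧
      dead S (step (step L₁.erase L₂) L₃) ≤ deadAt S (step (step L₁.erase L₂) L₃) b ∧
      forcing S (step (step L₁.erase L₂) L₃) a ≤ forcingAt S (step (step L₁.erase L₂) L₃) b a ∧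
      dead S (step (step L₁.erase L₂) L₃) + forcing S (step (step L₁.erase L₂) L₃) b ≤ 3 := by
  obtain ⟨x, y, hxy, rfl⟩ := Finset.card_eq_two.1 h₁
  obtain ⟨e, hex, hey, hR⟩ := exists_mem_step_two_three hxy (L₃ := L₃) h₂
  obtain ⟨a, b, hab, rfl, he⟩ : ∃ a b, a ≠ b ∧ L₃ = {a, b} ∧ (e = a ∨ e ∉ L₃) := by
    obtain ⟨a, b, hab, rfl⟩ := Finset.card_eq_two.1 h₃
    by_cases heb : e = b
    · exact ⟨b, a, hab.symm, Finset.pair_comm _ _, .inl heb⟩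
    · exact ⟨a, b, hab, rfl, by simp; tauto⟩
  have hf : Fits (step (step ({x, y} : Finset ℕ).erase L₂) {a, b}) a b := fits_step _ hab
  refine ⟨a, b, hf, count_mono fun z _ => ?_, count_mono fun z _ => ?_, ?_⟩
  · rw [hf.eq_empty, hR, hR]
    simp only [Finset.mem_insert, Finset.mem_singleton] at he ⊢
    grind
  · rw [hf.eq_left, hR, hR]
    simp only [Finset.mem_insert, Finset.mem_singleton] at he ⊢
    grind
  · classical
    refine (add_count_le (T := fun z => z ∈ ({x, y, a} : Finset ℕ)) fun z _ => ?_).trans ?_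
    · rw [hf.eq_empty, hf.eq_right, hR, hR]
      simp only [Finset.mem_insert, Finset.mem_singleton] at he ⊢
      grind
    · rw [count_eq_card]
      exact (Finset.card_le_card (fun z hz => (Finset.mem_filter.1 hz).2)).trans
        Finset.card_le_three

/-- Inequalities for the counts at the last vertex, with list `{a, b}`, of a path whose lists have
the sizes `2, 3, 2, 2, 2`; this is one half of the path with sizes `2, 3, 2, 2, 2, 2, 2, 2, 3, 2`.
The field `tight` describes the two cases in which the total of seven could be reached. -/
structure HalfBound (S : Finset ℕ) (R : ℕ → Finset ℕ) (a b : ℕ) : Prop where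
  fits : Fits R a b
  dead_le : dead S R ≤ 3
  zero : dead S R = 0 → forcing S R a + forcing S R b ≤ 6
  one : dead S R = 1 → forcing S R a + forcing S R b ≤ 4
  two : dead S R = 2 → forcing S R a + forcing S R b ≤ 3
  three : dead S R = 3 → forcing S R a + forcing S R b ≤ 1
  tight : dead S R = 2 ∧ forcing S R a + forcing S R b = 3 ∨
    dead S R = 3 ∧ forcing S R a + forcing S R b = 1 →
    (1 ≤ deadAt S R b ∧ 1 ≤ forcing S R b ∧ 1 ≤ deadAt S R a + forcingAt S R a b) ∨
    (1 ≤ deadAt S R a ∧ 1 ≤ forcing S R a ∧ 1 ≤ deadAt S R b + forcingAt S R b a)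

theorem exists_halfBound (S : Finset ℕ) {L₁ L₂ L₃ L₄ L₅ : Finset ℕ} (h₁ : #L₁ = 2)
    (h₂ : #L₂ = 3) (h₃ : #L₃ = 2) (h₄ : #L₄ = 2) (h₅ : #L₅ = 2) :
    ∃ a b, HalfBound S (step (step (step (step L₁.erase L₂) L₃) L₄) L₅) a b := by
  obtain ⟨a, b, f, h1, h2, h3⟩ := exists_fits_two_three_two S h₁ h₂ h₃
  obtain ⟨a', b', -, f', s1⟩ := f.exists_follows S h₄
  obtain ⟨a'', b'', -, f'', s2⟩ := f'.exists_follows S h₅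
  have hb := f.basic S
  have hb' := f'.basic S
  have hb'' := f''.basic S
  unfold Follows at s1 s2
  generalize step (step (step (step L₁.erase L₂) L₃) L₄) L₅ = R'' at f'' hb'' s2 ⊢
  generalize step (step (step L₁.erase L₂) L₃) L₄ = R' at hb hb' s1 s2
  generalize step (step L₁.erase L₂) L₃ = R at hb h1 h2 h3 s1
  refine ⟨a'', b'', f'', ?_, ?_, ?_, ?_, ?_, ?_⟩ <;>
    rcases s1 with s1 | s1 | s1 | s1 <;> rcases s2 with s2 | s2 | s2 | s2 <;> omega

/-- Two halves cannot both be in a tight case if every color of `S` counts only once, that is, if no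
color is dead in both halves and every forcing color forces the same color in both halves. -/
theorem not_tight {S : Finset ℕ} {R R' : ℕ → Finset ℕ} {a b c d : ℕ} (h : Fits R a b)
    (h' : Fits R' c d) (hempty : ∀ z ∈ S, R z = ∅ → R' z ≠ ∅)
    (hleft : ∀ z ∈ S, R z = {b} → R' z = R z) (hright : ∀ z ∈ S, R' z = {d} → R' z = R z)
    (t : 1 ≤ deadAt S R b ∧ 1 ≤ forcing S R b ∧ 1 ≤ deadAt S R a + forcingAt S R a b)
    (t' : 1 ≤ deadAt S R' d ∧ 1 ≤ forcing S R' d ∧ 1 ≤ deadAt S R' c + forcingAt S R' c d) :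
    False := by
  have aux : ∀ {R : ℕ → Finset ℕ} {a b : ℕ},
      1 ≤ deadAt S R b ∧ 1 ≤ forcing S R b ∧ 1 ≤ deadAt S R a + forcingAt S R a b →
      (b ∈ S ∧ R b = ∅) ∧ (∃ z ∈ S, R z = {b}) ∧ (a ∈ S ∧ (R a = ∅ ∨ R a = {b})) := by
    intro R a b ⟨h1, h2, h3⟩
    refine ⟨?_, exists_of_one_le_count h2, ?_⟩
    · obtain ⟨_, hz, rfl, h⟩ := exists_of_one_le_count h1
      exact ⟨hz, h⟩
    · rcases Nat.add_pos_iff_pos_or_pos.1 h3 with h | h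
      · obtain ⟨_, hz, rfl, e⟩ := exists_of_one_le_count h
        exact ⟨hz, .inl e⟩
      · obtain ⟨_, hz, rfl, e⟩ := exists_of_one_le_count h
        exact ⟨hz, .inr e⟩
  obtain ⟨⟨hbS, hb⟩, ⟨z, hz, hzb⟩, haS, ha⟩ := aux t
  obtain ⟨⟨hdS, hd⟩, ⟨w, hw, hwd⟩, hcS, hc⟩ := aux t'
  have hbd : b ≠ d := by rintro rfl; exact hempty b hbS hb hd
  have hbc : b = c := (h'.sub z b (by simp [hleft z hz hzb, hzb])).resolve_right hbd
  have hda : d = a := (h.sub w d (by simp [← hright w hw hwd, hwd])).resolve_right hbd.symm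
  subst hda
  have hR := ha.resolve_left fun e => hempty d hdS e hd
  have := hleft d haS hR
  rw [hd, hR] at this
  exact Finset.singleton_ne_empty _ this.symm

/-- Two halves of a path cannot be incompatible for exactly seven colors: a color for which they are
incompatible is dead in one half, or forces the same color on both sides of the middle edge. -/
theorem HalfBound.card_ne_seven {S : Finset ℕ} {R R' : ℕ → Finset ℕ} {a b c d : ℕ}
    (h : HalfBound S R a b) (h' : HalfBound S R' c d)
    (hS : ∀ z ∈ S, ∀ p ∈ R z, ∀ q ∈ R' z, p = q) : #S ≠ 7 := by
  have f := h.fits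
  have f' := h'.fits
  have hsingle : ∀ z ∈ S, R z = ∅ ∨ R' z = ∅ ∨
      (R z = {a} ∨ R z = {b}) ∧ (R' z = {c} ∨ R' z = {d}) ∧ R' z = R z := by
    intro z hz
    rcases (R z).eq_empty_or_nonempty with e | ⟨p, hp⟩
    · exact .inl e
    rcases (R' z).eq_empty_or_nonempty with e | ⟨q, hq⟩
    · exact .inr (.inl e)
    have h1 : R z = {q} := Finset.eq_singleton_iff_unique_mem.2
      ⟨hS z hz p hp q hq ▸ hp, fun r hr => hS z hz r hr q hq⟩
    have h2 : R' z = {q} := Finset.eq_singleton_iff_unique_mem.2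
      ⟨hq, fun r hr => (hS z hz p hp r hr).symm.trans (hS z hz p hp q hq)⟩
    refine .inr (.inr ⟨?_, ?_, h2.trans h1.symm⟩)
    · rcases f.sub z q (by simp [h1]) with rfl | rfl <;> simp [h1]
    · rcases f'.sub z q (by simp [h2]) with rfl | rfl <;> simp [h2]
  -- the colors forcing the same color on both sides
  set P : ℕ → Prop := fun z => (R z = {a} ∨ R z = {b}) ∧ (R' z = {c} ∨ R' z = {d}) ∧ R' z = R z
    with hP
  have hcard : count S (fun _ => True) = #S := by simp [count]
  have h1 : #S + count S (fun z => R z = ∅ ∧ R' z = ∅) ≤ dead S R + dead S R' + count S P := by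
    classical
    rw [← hcard]
    simp only [dead, count, ← Finset.sum_add_distrib]
    refine Finset.sum_le_sum fun z hz => ?_
    have := hsingle z hz
    simp only [hP]
    split_ifs <;> simp_all
  have h2 : count S P + count S (fun z => (R z = {a} ∨ R z = {b}) ∧ R' z ≠ R z) ≤
      forcing S R a + forcing S R b := by
    refine (add_count_le (T := fun z => R z = {a} ∨ R z = {b}) fun z _ => ?_).trans
      (count_le_add fun z _ => id)
    simp only [hP]
    tauto
  have h3 : count S P + count S (fun z => (R' z = {c} ∨ R' z = {d}) ∧ R' z ≠ R z) ≤
      forcing S R' c + forcing S R' d := by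
    refine (add_count_le (T := fun z => R' z = {c} ∨ R' z = {d}) fun z _ => ?_).trans
      (count_le_add fun z _ => id)
    simp only [hP]
    tauto
  intro h7
  obtain ⟨-, hle, e0, e1, e2, e3, t⟩ := h
  obtain ⟨-, hle', e0', e1', e2', e3', t'⟩ := h'
  have key : (count S (fun z => R z = ∅ ∧ R' z = ∅) = 0 ∧
      count S (fun z => (R z = {a} ∨ R z = {b}) ∧ R' z ≠ R z) = 0 ∧
      count S (fun z => (R' z = {c} ∨ R' z = {d}) ∧ R' z ≠ R z) = 0) ∧
      (dead S R = 2 ∧ forcing S R a + forcing S R b = 3 ∨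
        dead S R = 3 ∧ forcing S R a + forcing S R b = 1) ∧
      (dead S R' = 2 ∧ forcing S R' c + forcing S R' d = 3 ∨
        dead S R' = 3 ∧ forcing S R' c + forcing S R' d = 1) := by
    clear t t' hsingle hS hcard
    have i : dead S R = 0 ∨ dead S R = 1 ∨ dead S R = 2 ∨ dead S R = 3 := by omega
    have i' : dead S R' = 0 ∨ dead S R' = 1 ∨ dead S R' = 2 ∨ dead S R' = 3 := by omega
    -- only the totals `2 + 2 + 3` and `3 + 3 + 1` reach seven, and both are tight
    rcases i with i | i | i | i <;> rcases i' with i' | i' | i' | i' <;>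
      simp only [i, i', forall_const, OfNat.ofNat_ne_zero, OfNat.ofNat_ne_one, OfNat.zero_ne_ofNat,
        OfNat.one_ne_ofNat, zero_ne_one, one_ne_zero, IsEmpty.forall_iff, Nat.reduceEqDiff,
        true_and, false_and, false_or, or_false] at * <;> omega
  obtain ⟨⟨z1, z2, z3⟩, k, k'⟩ := key
  have hzero : ∀ {Q : ℕ → Prop}, count S Q = 0 → ∀ z ∈ S, ¬ Q z := by
    intro Q h0 z hz hq
    classical
    rw [count_eq_card, Finset.card_eq_zero] at h0
    exact Finset.notMem_empty z (h0 ▸ Finset.mem_filter.2 ⟨hz, hq⟩)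
  have y1 : ∀ z ∈ S, R z = ∅ → R' z ≠ ∅ := fun z hz h h' => hzero z1 z hz ⟨h, h'⟩
  have y2 : ∀ z ∈ S, R z = {a} ∨ R z = {b} → R' z = R z :=
    fun z hz h => not_not.1 fun h' => hzero z2 z hz ⟨h, h'⟩
  have y3 : ∀ z ∈ S, R' z = {c} ∨ R' z = {d} → R' z = R z :=
    fun z hz h => not_not.1 fun h' => hzero z3 z hz ⟨h, h'⟩
  rcases t k with t | t <;> rcases t' k' with t' | t'
  · exact not_tight f f' y1 (fun z hz e => y2 z hz (.inr e)) (fun z hz e => y3 z hz (.inr e)) t t'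
  · exact not_tight f f'.symm y1 (fun z hz e => y2 z hz (.inr e))
      (fun z hz e => y3 z hz (.inl e)) t t'
  · exact not_tight f.symm f' y1 (fun z hz e => y2 z hz (.inl e))
      (fun z hz e => y3 z hz (.inr e)) t t'
  · exact not_tight f.symm f'.symm y1 (fun z hz e => y2 z hz (.inl e))
      (fun z hz e => y3 z hz (.inl e)) t t'

/-- A path whose lists have the sizes `2, 3, 2, 2, 2, 2, 2, 2, 3, 2` can be colored without using
`z`, for a suitable `z` out of any seven colors. -/
theorem exists_path_coloring {S : Finset ℕ} (hS : #S = 7) {L : Fin 10 → Finset ℕ}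
    (hL : ∀ i, #(L i) = ![2, 3, 2, 2, 2, 2, 2, 2, 3, 2] i) :
    ∃ z ∈ S, ∃ c : Fin 10 → ℕ, (∀ i, c i ∈ L i ∧ c i ≠ z) ∧ c 0 ≠ c 1 ∧ c 1 ≠ c 2 ∧ c 2 ≠ c 3 ∧
      c 3 ≠ c 4 ∧ c 4 ≠ c 5 ∧ c 5 ≠ c 6 ∧ c 6 ≠ c 7 ∧ c 7 ≠ c 8 ∧ c 8 ≠ c 9 := by
  obtain ⟨a, b, h⟩ := exists_halfBound S (hL 0) (hL 1) (hL 2) (hL 3) (hL 4)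
  obtain ⟨c, d, h'⟩ := exists_halfBound S (hL 9) (hL 8) (hL 7) (hL 6) (hL 5)
  by_contra! hcon
  refine h.card_ne_seven h' (fun z hz p hp q hq => ?_) hS
  simp only [mem_step, Finset.mem_erase] at hp hq
  obtain ⟨p5, pz5, p4, ⟨q4, pz4, p3, ⟨q3, pz3, p2, ⟨q2, pz2, p1, ⟨pz1, q1⟩, n1⟩, n2⟩, n3⟩, n4⟩ := hp
  obtain ⟨u5, uz5, u4, ⟨v4, uz4, u3, ⟨v3, uz3, u2, ⟨v2, uz2, u1, ⟨uz1, v1⟩, m1⟩, m2⟩, m3⟩, m4⟩ := hq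
  by_contra hpq
  refine absurd (hcon z hz ![p1, p2, p3, p4, p, q, u4, u3, u2, u1] ?_ n1 n2 n3 n4 hpq m4.symm
    m3.symm m2.symm) m1.symm
  intro i
  fin_cases i <;> exact ⟨‹_›, ‹_›⟩

/-! ### Greedy colorings and the greedy bound -/

/-- The number of neighbors of `v` that precede `v`. -/
noncomputable def backDegree {n : ℕ} (G : SimpleGraph (Fin n)) (v : Fin n) : ℕ := by
  classical exact #{u | u < v ∧ G.Adj u v}

theorem backDegree_eq_card {n : ℕ} {G : SimpleGraph (Fin n)} {v : Fin n} {s : Finset (Fin n)}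
    (h : ∀ u, u ∈ s ↔ u < v ∧ G.Adj u v) : backDegree G v = #s := by
  classical
  unfold backDegree
  congr 1
  ext u
  simp [h]

theorem ncard_edgeSet_eq_sum_backDegree {n : ℕ} (G : SimpleGraph (Fin n)) :
    G.edgeSet.ncard = ∑ v, backDegree G v := by
  classical
  simp only [backDegree]
  rw [← Finset.card_sigma, ← Set.ncard_coe_finset]
  symm
  refine Set.ncard_congr (fun p _ => s(p.2, p.1)) ?_ ?_ ?_
  · rintro ⟨v, u⟩ h
    simp only [Finset.coe_sigma, Set.mem_sigma_iff, Finset.mem_coe, Finset.mem_filter] at h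
    exact h.2.2.2
  · rintro ⟨v, u⟩ ⟨v', u'⟩ h h' e
    simp only [Finset.coe_sigma, Set.mem_sigma_iff, Finset.mem_coe, Finset.mem_filter] at h h'
    rcases Sym2.eq_iff.1 e with ⟨h1, h2⟩ | ⟨h1, h2⟩
    · simp_all
    · have := h.2.2.1
      have := h'.2.2.1
      simp only at h1 h2
      omega
  · intro e he
    induction e with
    | _ u v =>
      have ha : G.Adj u v := he
      rcases lt_or_gt_of_ne ha.ne with h | h
      · exact ⟨⟨v, u⟩, by simp [h, ha], rfl⟩
      · exact ⟨⟨u, v⟩, by simp [h, ha.symm], Sym2.eq_swap⟩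

/-- A proper coloring of the first `m` vertices extends greedily to the whole graph if the lists
of the remaining vertices are longer than their numbers of preceding neighbors. -/
theorem listColorable_of_partial {n : ℕ} (G : SimpleGraph (Fin n)) (L : Fin n → Finset ℕ) (m : ℕ)
    (C : Fin n → ℕ) (hC : ∀ v : Fin n, v.val < m → C v ∈ L v)
    (hadj : ∀ u v : Fin n, u < v → v.val < m → G.Adj u v → C u ≠ C v)
    (hL : ∀ v : Fin n, m ≤ v.val → backDegree G v < #(L v)) : ListColorable G L := by
  classical
  have key : ∀ j, ∃ C : Fin n → ℕ, (∀ v : Fin n, v.val < m + j → C v ∈ L v) ∧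
      ∀ u v : Fin n, u < v → v.val < m + j → G.Adj u v → C u ≠ C v := by
    intro j
    induction j with
    | zero => exact ⟨C, hC, hadj⟩
    | succ j ih =>
      obtain ⟨C, h1, h2⟩ := ih
      by_cases hj : m + j < n
      · set w : Fin n := ⟨m + j, hj⟩ with hw
        obtain ⟨q, hq, hqn⟩ : ∃ q ∈ L w,
            q ∉ ({u | u < w ∧ G.Adj u w} : Finset (Fin n)).image C := by
          refine Finset.exists_mem_notMem_of_card_lt_card (Finset.card_image_le.trans_lt ?_)
          have := hL w (by simp [hw])
          unfold backDegree at this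
          convert this
        refine ⟨Function.update C w q, fun v hv => ?_, fun u v huv hv ha => ?_⟩
        · by_cases hvw : v = w
          · subst hvw; simpa using hq
          · rw [Function.update_of_ne hvw]
            have : v.val ≠ m + j := fun e => hvw (Fin.ext e)
            exact h1 v (by omega)
        · have huw : u ≠ w := by
            rintro rfl
            have : m + j < v.val := huv
            omega
          rw [Function.update_of_ne huw]
          by_cases hvw : v = w
          · subst hvw
            rw [Function.update_self]
            rintro rfl
            exact hqn (Finset.mem_image_of_mem _ (by simp [huv, ha]))
          · rw [Function.update_of_ne hvw]
            have : v.val ≠ m + j := fun e => hvw (Fin.ext e)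
            exact h2 u v huv (by omega) ha
      · exact ⟨C, fun v _ => h1 v (by omega), fun u v huv _ => h2 u v huv (by omega)⟩
  obtain ⟨C, h1, h2⟩ := key n
  refine ⟨SimpleGraph.Coloring.mk C fun {u v} ha => ?_, fun v => h1 v (by omega)⟩
  rcases lt_or_gt_of_ne ha.ne with h | h
  · exact h2 u v h (by omega) ha
  · exact (h2 v u h (by omega) ha.symm).symm

theorem sumChoiceNumber_le {V : Type*} [Fintype V] {G : SimpleGraph V} {f : V → ℕ}
    (hf : IsChoiceFunction G f) : sumChoiceNumber G ≤ size f :=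
  Nat.sInf_le ⟨f, hf, rfl⟩

theorem le_sumChoiceNumber {V : Type*} [Fintype V] {G : SimpleGraph V} {m : ℕ}
    (h : ∀ f, IsChoiceFunction G f → m ≤ size f) : m ≤ sumChoiceNumber G := by
  obtain ⟨f, hf⟩ := exists_isChoiceFunction G
  refine le_csInf ⟨_, f, hf, rfl⟩ ?_
  rintro _ ⟨f, hf, rfl⟩
  exact h f hf

theorem greedyBound_eq {n : ℕ} (G : SimpleGraph (Fin n)) :
    greedyBound G = n + ∑ v, backDegree G v := by
  rw [greedyBound, Fintype.card_fin, ncard_edgeSet_eq_sum_backDegree]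

theorem sumChoiceNumber_le_greedyBound {n : ℕ} (G : SimpleGraph (Fin n)) :
    sumChoiceNumber G ≤ greedyBound G := by
  have hf : IsChoiceFunction G (fun v => backDegree G v + 1) := fun L hL =>
    listColorable_of_partial G L 0 (fun _ => 0) (by simp) (by simp) fun v _ => by rw [hL v]; simp
  refine (sumChoiceNumber_le hf).trans ?_
  rw [greedyBound_eq, size, Finset.sum_add_distrib]
  simp [add_comm]

theorem scGreedy_of_le {n : ℕ} {G : SimpleGraph (Fin n)}
    (h : ∀ f, IsChoiceFunction G f → greedyBound G ≤ size f) : ScGreedy G :=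
  (sumChoiceNumber_le_greedyBound G).antisymm (le_sumChoiceNumber h)

theorem not_scGreedy_of_lt {V : Type*} [Fintype V] {G : SimpleGraph V} {f : V → ℕ}
    (hf : IsChoiceFunction G f) (h : size f < greedyBound G) : ¬ ScGreedy G :=
  fun e => absurd (sumChoiceNumber_le hf) (by rw [e]; omega)

/-! ### The edges of fans and wheels -/

theorem brokenWheel_adj {k : ℕ} {u v : Fin (k + 1)} (huv : u < v) :
    (brokenWheel k).Adj u v ↔ u.val = 0 ∨ u.val + 1 = v.val := by
  simp only [brokenWheel, SimpleGraph.fromRel_adj, ne_eq, Fin.ext_iff]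
  have : u.val < v.val := huv
  omega

theorem wheel_adj {k : ℕ} {u v : Fin (k + 1)} (huv : u < v) :
    (wheel k).Adj u v ↔ u.val = 0 ∨ u.val + 1 = v.val ∨ u.val = 1 ∧ v.val = k := by
  simp only [wheel, SimpleGraph.fromRel_adj, ne_eq, Fin.ext_iff]
  have : u.val < v.val := huv
  omega

theorem backDegree_brokenWheel {k : ℕ} (v : Fin (k + 1)) :
    backDegree (brokenWheel k) v = min v.val 2 := by
  obtain ⟨v, hv⟩ := v
  rcases v with _ | _ | v
  · refine (backDegree_eq_card (s := ∅) fun u => ?_).trans rfl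
    simp
  · refine (backDegree_eq_card (s := {⟨0, by omega⟩}) fun u => ?_).trans rfl
    refine ⟨?_, fun ⟨h, _⟩ => ?_⟩
    · simp only [Finset.mem_singleton]
      rintro rfl
      exact ⟨Fin.lt_def.2 (by simp), (brokenWheel_adj (Fin.lt_def.2 (by simp))).2 (by simp)⟩
    · simp only [Fin.lt_def, Finset.mem_singleton, Fin.ext_iff] at h ⊢
      omega
  · refine (backDegree_eq_card (s := {⟨0, by omega⟩, ⟨v + 1, by omega⟩}) fun u => ?_).trans ?_
    · rw [Finset.mem_insert, Finset.mem_singleton, Fin.ext_iff, Fin.ext_iff]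
      change u.val = 0 ∨ u.val = v + 1 ↔ _
      constructor
      · intro h
        have hlt : u < ⟨v + 1 + 1, hv⟩ := Fin.lt_def.2 (by change u.val < v + 1 + 1; omega)
        refine ⟨hlt, (brokenWheel_adj hlt).2 ?_⟩
        change u.val = 0 ∨ u.val + 1 = v + 1 + 1
        omega
      · rintro ⟨hlt, ha⟩
        rw [brokenWheel_adj hlt] at ha
        change u.val = 0 ∨ u.val + 1 = v + 1 + 1 at ha
        omega
    · rw [Finset.card_pair (by simp [Fin.ext_iff])]
      simp

theorem backDegree_wheel {k : ℕ} (hk : 3 ≤ k) (v : Fin (k + 1)) :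
    backDegree (wheel k) v = min v.val 2 + if v.val = k then 1 else 0 := by
  split_ifs with h
  · refine (backDegree_eq_card (s := {⟨0, by omega⟩, ⟨1, by omega⟩, ⟨k - 1, by omega⟩})
      fun u => ?_).trans ?_
    · rw [Finset.mem_insert, Finset.mem_insert, Finset.mem_singleton, Fin.ext_iff, Fin.ext_iff,
        Fin.ext_iff]
      change u.val = 0 ∨ u.val = 1 ∨ u.val = k - 1 ↔ _
      constructor
      · intro hu
        have hlt : u < v := Fin.lt_def.2 (by omega)
        exact ⟨hlt, (wheel_adj hlt).2 (by omega)⟩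
      · rintro ⟨hlt, ha⟩
        rw [wheel_adj hlt] at ha
        omega
    · rw [Finset.card_eq_three.2 ⟨_, _, _, ?_, ?_, ?_, rfl⟩]
      · omega
      · rw [Ne, Fin.ext_iff]; exact Nat.zero_ne_one
      · rw [Ne, Fin.ext_iff]; change ¬ 0 = k - 1; omega
      · rw [Ne, Fin.ext_iff]; change ¬ 1 = k - 1; omega
  · refine Eq.trans ?_ (backDegree_brokenWheel v)
    classical
    refine (backDegree_eq_card (s := {u | u < v ∧ (brokenWheel k).Adj u v}) fun u => ?_).trans ?_
    · simp only [Finset.mem_filter, Finset.mem_univ, true_and]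
      refine and_congr_right fun hlt => ?_
      rw [brokenWheel_adj hlt, wheel_adj hlt]
      tauto
    · exact (backDegree_eq_card fun u => by simp).symm

theorem sum_min_two (k : ℕ) : ∑ i ∈ Finset.range (k + 1), min i 2 = 2 * k - 1 := by
  induction k with
  | zero => rfl
  | succ k ih => rw [Finset.sum_range_succ, ih]; omega

theorem greedyBound_brokenWheel (k : ℕ) : greedyBound (brokenWheel k) = max (3 * k) 1 := by
  rw [greedyBound_eq]
  simp only [backDegree_brokenWheel]
  rw [Fin.sum_univ_eq_sum_range (fun i => min i 2), sum_min_two]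
  omega

theorem greedyBound_wheel {k : ℕ} (hk : 3 ≤ k) : greedyBound (wheel k) = 3 * k + 1 := by
  rw [greedyBound_eq]
  simp only [backDegree_wheel hk]
  rw [Fin.sum_univ_eq_sum_range (fun i => min i 2 + if i = k then 1 else 0),
    Finset.sum_add_distrib, sum_min_two]
  simp
  omega

/-! ### Long fans and wheels -/

/-- The sizes of the lists of the hub and the first ten rim vertices; any further rim vertex has a
list of size `3`. -/
def longSize : ℕ → ℕ
  | 0 => 7
  | 1 => 2
  | 2 => 3
  | 3 => 2
  | 4 => 2
  | 5 => 2
  | 6 => 2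
  | 7 => 2
  | 8 => 2
  | 9 => 3
  | 10 => 2
  | _ => 3

theorem sum_longSize {k : ℕ} (hk : 10 ≤ k) :
    ∑ i ∈ Finset.range (k + 1), longSize i = 3 * k - 1 := by
  induction k, hk using Nat.le_induction with
  | base => rfl
  | succ k hk ih =>
    have : longSize (k + 1) = 3 := by
      obtain ⟨j, rfl⟩ := Nat.exists_eq_add_of_le' hk
      rfl
    rw [Finset.sum_range_succ, ih, this]
    omega

/-- The hub and the first ten rim vertices of a fan or wheel can be colored from lists of the sizes
`longSize`. -/
theorem exists_partial_coloring {k : ℕ} (hk : 10 ≤ k) {G : SimpleGraph (Fin (k + 1))}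
    (hG : ∀ u v : Fin (k + 1), u < v → v.val ≤ 10 → G.Adj u v → u.val = 0 ∨ u.val + 1 = v.val)
    {L : Fin (k + 1) → Finset ℕ} (hL : ∀ v : Fin (k + 1), v.val ≤ 10 → #(L v) = longSize v) :
    ∃ C : Fin (k + 1) → ℕ, (∀ v : Fin (k + 1), v.val < 11 → C v ∈ L v) ∧
      ∀ u v : Fin (k + 1), u < v → v.val < 11 → G.Adj u v → C u ≠ C v := by
  obtain ⟨z, hz, c, hc, h0, h1, h2, h3, h4, h5, h6, h7, h8⟩ := exists_path_coloring
    (S := L ⟨0, by omega⟩) (hL _ (Nat.zero_le _)) (L := fun i => L ⟨i.val + 1, by omega⟩) (by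
      intro i
      rw [hL _ (Nat.succ_le_of_lt i.isLt)]
      fin_cases i <;> rfl)
  have hpath : ∀ i (hi : i + 1 < 10), c ⟨i, by omega⟩ ≠ c ⟨i + 1, hi⟩ := by
    intro i hi
    have hi' : i < 9 := by omega
    interval_cases i <;> assumption
  refine ⟨fun v => if h : 0 < v.val ∧ v.val < 11 then c ⟨v.val - 1, by omega⟩ else z,
    fun v hv => ?_, fun u v huv hv ha => ?_⟩
  · by_cases h0 : 0 < v.val
    · simp only [h0, hv, and_self, dite_true]
      have := (hc ⟨v.val - 1, by omega⟩).1
      simp only [Nat.sub_add_cancel h0] at this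
      exact this
    · have : v = ⟨0, Nat.succ_pos k⟩ := Fin.ext (Nat.eq_zero_of_not_pos h0)
      simp only [h0, false_and, dite_false]
      rw [this]
      exact hz
  · have huv' : u.val < v.val := huv
    have hv0 : 0 < v.val := by omega
    simp only [hv0, hv, and_self, dite_true]
    by_cases hu0 : 0 < u.val
    · have he : u.val + 1 = v.val := by
        rcases hG u v huv (by omega) ha with h | h <;> omega
      have hu : u.val < 11 := by omega
      simp only [hu0, hu, and_self, dite_true]
      have := hpath (u.val - 1) (by omega)
      simp only [Nat.sub_add_cancel hu0] at this
      convert this using 3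
      omega
    · simp only [hu0, false_and, dite_false]
      exact (hc _).2.symm

theorem not_scGreedy_brokenWheel {k : ℕ} (hk : 10 ≤ k) : ¬ ScGreedy (brokenWheel k) := by
  refine not_scGreedy_of_lt (f := fun v => longSize v) (fun L hL => ?_) ?_
  · obtain ⟨C, h1, h2⟩ := exists_partial_coloring hk (G := brokenWheel k) (L := L)
      (fun u v huv _ ha => (brokenWheel_adj huv).1 ha) fun v _ => hL v
    refine listColorable_of_partial _ L 11 C h1 h2 fun v hv => ?_
    rw [hL v, backDegree_brokenWheel]
    change _ < longSize v
    obtain ⟨j, hj⟩ := Nat.exists_eq_add_of_le' hv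
    rw [hj]
    change min (j + 11) 2 < 3
    omega
  · rw [greedyBound_brokenWheel, size, Fin.sum_univ_eq_sum_range longSize, sum_longSize hk]
    omega

theorem not_scGreedy_wheel {k : ℕ} (hk : 11 ≤ k) : ¬ ScGreedy (wheel k) := by
  refine not_scGreedy_of_lt (f := fun v => longSize v + if v.val = k then 1 else 0)
    (fun L hL => ?_) ?_
  · obtain ⟨C, h1, h2⟩ := exists_partial_coloring (by omega) (G := wheel k) (L := L)
      (fun u v huv hv ha => by rw [wheel_adj huv] at ha; omega)
      fun v hv => by
        rw [hL v]
        change longSize v + (if v.val = k then 1 else 0) = _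
        rw [if_neg (by omega), Nat.add_zero]
    refine listColorable_of_partial _ L 11 C h1 h2 fun v hv => ?_
    rw [hL v, backDegree_wheel (by omega)]
    refine Nat.add_lt_add_right ?_ _
    obtain ⟨j, hj⟩ := Nat.exists_eq_add_of_le' hv
    rw [hj]
    change min (j + 11) 2 < 3
    omega
  · rw [greedyBound_wheel (by omega), size,
      Fin.sum_univ_eq_sum_range (fun i => longSize i + if i = k then 1 else 0),
      Finset.sum_add_distrib, sum_longSize (by omega)]
    simp
    omega

/-! ### The wheel with four spokes -/

theorem exists_mem_ne_ne {L : Finset ℕ} (hL : 2 < #L) (u v : ℕ) : ∃ x ∈ L, x ≠ u ∧ x ≠ v := by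
  obtain ⟨x, hx, hn⟩ := Finset.exists_mem_notMem_of_card_lt_card
    (Finset.card_le_two.trans_lt hL : #{u, v} < #L)
  exact ⟨x, hx, by simpa using hn⟩

/-- The wheel with four spokes when the lists `{a, b}` and `{c, d}` of two opposite rim vertices
are disjoint and the color `a` is not in the list `L₄` of size three: using `a` at the first
vertex or the hub leaves a color for the vertex with list `L₄`. -/
theorem exists_cycle_coloring_aux {S L₂ L₄ : Finset ℕ} {a b c d : ℕ} (hS : #S = 3) (h₂ : #L₂ = 2)
    (h₄ : #L₄ = 3) (hab : a ≠ b) (hcd : c ≠ d) (hac : a ≠ c) (had : a ≠ d) (hbc : b ≠ c)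
    (hbd : b ≠ d) (ha : a ∉ L₄) :
    ∃ t ∈ S, ∃ c₁, (c₁ = a ∨ c₁ = b) ∧ ∃ c₂ ∈ L₂, ∃ c₃, (c₃ = c ∨ c₃ = d) ∧ ∃ c₄ ∈ L₄,
      c₁ ≠ c₂ ∧ c₂ ≠ c₃ ∧ c₃ ≠ c₄ ∧ c₄ ≠ c₁ ∧ t ≠ c₁ ∧ t ≠ c₂ ∧ t ≠ c₃ ∧ t ≠ c₄ := by
  -- it suffices to color the path and the hub, with `a` used at the first vertex or the hub
  suffices h : ∃ t ∈ S, ∃ c₁, (c₁ = a ∨ c₁ = b) ∧ ∃ c₂ ∈ L₂, ∃ c₃, (c₃ = c ∨ c₃ = d) ∧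
      (t = a ∨ c₁ = a) ∧ c₁ ≠ c₂ ∧ c₂ ≠ c₃ ∧ t ≠ c₁ ∧ t ≠ c₂ ∧ t ≠ c₃ by
    obtain ⟨t, ht, c₁, hc₁, c₂, hc₂, c₃, hc₃, hta, h⟩ := h
    rcases hta with rfl | rfl
    · obtain ⟨c₄, hc₄, h1, h2⟩ := exists_mem_ne_ne (h₄.symm ▸ (by omega : 2 < 3)) c₁ c₃
      exact ⟨t, ht, c₁, hc₁, c₂, hc₂, c₃, hc₃, c₄, hc₄, by grind⟩
    · obtain ⟨c₄, hc₄, h1, h2⟩ := exists_mem_ne_ne (h₄.symm ▸ (by omega : 2 < 3)) t c₃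
      exact ⟨t, ht, c₁, hc₁, c₂, hc₂, c₃, hc₃, c₄, hc₄, by grind⟩
  obtain ⟨e, f, hef, rfl⟩ := Finset.card_eq_two.1 h₂
  obtain ⟨x, y, z, hxy, hxz, hyz, rfl⟩ := Finset.card_eq_three.1 hS
  simp only [Finset.mem_insert, Finset.mem_singleton, exists_eq_or_imp, exists_eq_left]
  clear hS h₂ h₄ ha
  grind (splits := 20)

/-- The wheel with four spokes can be colored from lists of size `3` at the hub and sizes `2, 2,
2, 3` on the rim. -/
theorem exists_cycle_coloring {S L₁ L₂ L₃ L₄ : Finset ℕ} (hS : #S = 3) (h₁ : #L₁ = 2)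
    (h₂ : #L₂ = 2) (h₃ : #L₃ = 2) (h₄ : #L₄ = 3) :
    ∃ t ∈ S, ∃ c₁ ∈ L₁, ∃ c₂ ∈ L₂, ∃ c₃ ∈ L₃, ∃ c₄ ∈ L₄,
      c₁ ≠ c₂ ∧ c₂ ≠ c₃ ∧ c₃ ≠ c₄ ∧ c₄ ≠ c₁ ∧ t ≠ c₁ ∧ t ≠ c₂ ∧ t ≠ c₃ ∧ t ≠ c₄ := by
  by_cases hw : ∃ w, w ∈ L₁ ∧ w ∈ L₃
  · -- the same color `w` at two opposite rim vertices
    obtain ⟨w, hw1, hw3⟩ := hw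
    obtain ⟨p, hp, hpw⟩ := Finset.exists_mem_ne (by omega : 1 < #L₂) w
    obtain ⟨t, ht, htw, htp⟩ := exists_mem_ne_ne (by omega : 2 < #S) w p
    obtain ⟨q, hq, hqw, hqt⟩ := exists_mem_ne_ne (by omega : 2 < #L₄) w t
    exact ⟨t, ht, w, hw1, p, hp, w, hw3, q, hq, by grind⟩
  · push Not at hw
    obtain ⟨a, b, hab, rfl⟩ := Finset.card_eq_two.1 h₁
    obtain ⟨c, d, hcd, rfl⟩ := Finset.card_eq_two.1 h₃
    simp only [Finset.mem_insert, Finset.mem_singleton, forall_eq_or_imp, forall_eq, not_or] at hw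
    obtain ⟨⟨hac, had⟩, hbc, hbd⟩ := hw
    have hout : a ∉ L₄ ∨ b ∉ L₄ ∨ c ∉ L₄ ∨ d ∉ L₄ := by
      by_contra! h
      have : ({a, b, c, d} : Finset ℕ) ⊆ L₄ := by
        simp [Finset.insert_subset_iff, h]
      have := Finset.card_le_card this
      rw [Finset.card_insert_of_notMem (by simp [hab, hac, had]),
        Finset.card_insert_of_notMem (by simp [hbc, hbd]), Finset.card_pair hcd] at this
      omega
    simp only [Finset.mem_insert, Finset.mem_singleton]
    rcases hout with h | h | h | h
    · exact exists_cycle_coloring_aux hS h₂ h₄ hab hcd hac had hbc hbd h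
    · obtain ⟨t, ht, c₁, hc₁, r⟩ :=
        exists_cycle_coloring_aux hS h₂ h₄ hab.symm hcd hbc hbd hac had h
      exact ⟨t, ht, c₁, hc₁.symm, r⟩
    · obtain ⟨t, ht, c₃, hc₃, c₂, hc₂, c₁, hc₁, c₄, hc₄, r⟩ :=
        exists_cycle_coloring_aux hS h₂ h₄ hcd hab (Ne.symm hac) (Ne.symm hbc) (Ne.symm had)
          (Ne.symm hbd) h
      exact ⟨t, ht, c₁, hc₁, c₂, hc₂, c₃, hc₃, c₄, hc₄, by grind⟩
    · obtain ⟨t, ht, c₃, hc₃, c₂, hc₂, c₁, hc₁, c₄, hc₄, r⟩ :=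
        exists_cycle_coloring_aux hS h₂ h₄ hcd.symm hab (Ne.symm had) (Ne.symm hbd)
          (Ne.symm hac) (Ne.symm hbc) h
      exact ⟨t, ht, c₁, hc₁, c₂, hc₂, c₃, hc₃.symm, c₄, hc₄, by grind⟩

theorem not_scGreedy_wheel_four : ¬ ScGreedy (wheel 4) := by
  refine not_scGreedy_of_lt (f := ![3, 2, 2, 2, 3]) (fun L hL => ?_) ?_
  · obtain ⟨t, ht, c₁, h1, c₂, h2, c₃, h3, c₄, h4, h⟩ :=
      exists_cycle_coloring (hL 0) (hL 1) (hL 2) (hL 3) (hL 4)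
    refine listColorable_of_partial _ L 5 ![t, c₁, c₂, c₃, c₄] (fun v _ => ?_)
      (fun u v huv _ ha => ?_) fun v hv => absurd v.isLt (by omega)
    · fin_cases v <;> assumption
    · rw [wheel_adj huv] at ha
      obtain ⟨n1, n2, n3, n4, n5, n6, n7, n8⟩ := h
      fin_cases u <;> fin_cases v <;> simp at huv ha ⊢ <;> first | assumption | exact Ne.symm ‹_›
  · rw [greedyBound_wheel (by omega), size]
    simp [Fin.sum_univ_five]

/-! ### Lists on a path that block many colors -/

/-- A path with the lists `Ls` has a proper coloring from its lists that avoids the color `z` and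
does not start with the color `p`. -/
def PathColorable (z : ℕ) : ℕ → List (Finset ℕ) → Prop
  | _, [] => True
  | p, L :: Ls => ∃ q ∈ L, q ≠ z ∧ q ≠ p ∧ PathColorable z q Ls

instance decidablePathColorable (z : ℕ) :
    ∀ (p : ℕ) (Ls : List (Finset ℕ)), Decidable (PathColorable z p Ls)
  | _, [] => .isTrue trivial
  | p, L :: Ls =>
    have (q : ℕ) : Decidable (PathColorable z q Ls) := decidablePathColorable z q Ls
    inferInstanceAs (Decidable (∃ q ∈ L, q ≠ z ∧ q ≠ p ∧ PathColorable z q Ls))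

namespace PathColorable

variable {z p : ℕ}

theorem start {Ls : List (Finset ℕ)} (h : PathColorable z p Ls) : PathColorable z z Ls := by
  cases Ls with
  | nil => trivial
  | cons L Ls =>
    obtain ⟨q, hq, hz, _, h⟩ := h
    exact ⟨q, hq, hz, hz, h⟩

theorem left {A B : List (Finset ℕ)} (h : PathColorable z p (A ++ B)) : PathColorable z p A := by
  induction A generalizing p with
  | nil => trivial
  | cons L A ih =>
    obtain ⟨q, hq, hz, hp, h⟩ := h
    exact ⟨q, hq, hz, hp, ih h⟩

theorem right {A B : List (Finset ℕ)} (h : PathColorable z p (A ++ B)) :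
    PathColorable z z B := by
  induction A generalizing p with
  | nil => exact h.start
  | cons L A ih =>
    obtain ⟨q, -, -, -, h⟩ := h
    exact ih h

theorem of_map {φ : ℕ → ℕ} {Ls : List (Finset ℕ)}
    (h : PathColorable (φ z) (φ p) (Ls.map (Finset.image φ))) : PathColorable z p Ls := by
  induction Ls generalizing p with
  | nil => trivial
  | cons L Ls ih =>
    obtain ⟨q, hq, hz, hp, h⟩ := h
    obtain ⟨r, hr, rfl⟩ := Finset.mem_image.1 hq
    exact ⟨r, hr, fun e => hz (e ▸ rfl), fun e => hp (e ▸ rfl), ih h⟩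

theorem empty_notMem {Ls : List (Finset ℕ)} (h : PathColorable z p Ls) : ∅ ∉ Ls := by
  induction Ls generalizing p with
  | nil => simp
  | cons L Ls ih =>
    obtain ⟨q, hq, -, -, h⟩ := h
    simp only [List.mem_cons, not_or]
    exact ⟨(Finset.ne_empty_of_mem hq).symm, ih h⟩

theorem of_forall {Ls : List (Finset ℕ)} {c : ℕ → ℕ}
    (hc : ∀ i (hi : i < Ls.length), c i ∈ Ls[i] ∧ c i ≠ z)
    (hadj : ∀ i, i + 1 < Ls.length → c i ≠ c (i + 1)) (hp : 0 < Ls.length → c 0 ≠ p) :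
    PathColorable z p Ls := by
  induction Ls generalizing c p with
  | nil => trivial
  | cons L Ls ih =>
    have h0 := hc 0 (by simp)
    refine ⟨c 0, h0.1, h0.2, hp (by simp), ih (c := fun i => c (i + 1)) (fun i hi => ?_)
      (fun i hi => ?_) fun h => ?_⟩
    · exact hc (i + 1) (by simpa using hi)
    · exact hadj (i + 1) (by simpa using hi)
    · exact (hadj 0 (by simpa using h)).symm

end PathColorable

/-- There are lists of the sizes `s` on a path such that the removal of each of `m` colors makes the
path uncolorable. In a fan with these lists on the rim, the hub needs a list with more than `m`
colors. -/
def Blocks (s : List ℕ) (m : ℕ) : Prop :=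
  ∃ Ls : List (Finset ℕ), Ls.map Finset.card = s ∧
    ∃ S : Finset ℕ, m ≤ #S ∧ ∀ z ∈ S, ¬ PathColorable z z Ls

theorem blocks_zero (s : List ℕ) : Blocks s 0 :=
  ⟨s.map Finset.range, by simp [Function.comp_def], ∅, le_rfl, by simp⟩

theorem blocks_of_zero_mem {s : List ℕ} (h : 0 ∈ s) (m : ℕ) : Blocks s m :=
  ⟨s.map Finset.range, by simp [Function.comp_def], Finset.range m, by simp, fun _ _ hz =>
    hz.empty_notMem (List.mem_map.2 ⟨0, h, rfl⟩)⟩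

/-- The colors may be renamed. -/
theorem Blocks.rename {s : List ℕ} {m : ℕ} (h : Blocks s m) {φ : ℕ → ℕ}
    (hφ : Function.Injective φ) :
    ∃ Ls : List (Finset ℕ), Ls.map Finset.card = s ∧ (∀ L ∈ Ls, ∀ q ∈ L, q ∈ Set.range φ) ∧
      ∃ S : Finset ℕ, m ≤ #S ∧ ∀ z ∈ S, z ∈ Set.range φ ∧ ¬ PathColorable z z Ls := by
  obtain ⟨Ls, hs, S, hm, hS⟩ := h
  refine ⟨Ls.map (Finset.image φ), ?_, ?_, S.image φ, ?_, ?_⟩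
  · rw [List.map_map, ← hs]
    exact List.map_congr_left fun L _ => Finset.card_image_of_injective L hφ
  · intro L hL q hq
    obtain ⟨L, -, rfl⟩ := List.mem_map.1 hL
    obtain ⟨r, -, rfl⟩ := Finset.mem_image.1 hq
    exact ⟨r, rfl⟩
  · rwa [Finset.card_image_of_injective S hφ]
  · intro z hz
    obtain ⟨r, hr, rfl⟩ := Finset.mem_image.1 hz
    exact ⟨⟨r, rfl⟩, fun h => hS r hr h.of_map⟩

theorem Blocks.append {s t : List ℕ} {m n : ℕ} (hs : Blocks s m) (ht : Blocks t n) :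
    Blocks (s ++ t) (m + n) := by
  obtain ⟨A, hA, -, S, hm, hS⟩ := hs.rename (φ := fun i => 2 * i) fun i j h => by simpa using h
  obtain ⟨B, hB, -, T, hn, hT⟩ := ht.rename (φ := fun i => 2 * i + 1) fun i j h => by simpa using h
  refine ⟨A ++ B, by simp [hA, hB], S ∪ T, ?_, fun z hz h => ?_⟩
  · rw [Finset.card_union_of_disjoint]
    · omega
    · rw [Finset.disjoint_left]
      intro z hz hz'
      obtain ⟨i, hi⟩ := (hS z hz).1
      obtain ⟨j, hj⟩ := (hT z hz').1
      simp only at hi hj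
      omega
  · rcases Finset.mem_union.1 hz with hz | hz
    · exact (hS z hz).2 h.left
    · exact (hT z hz).2 h.right

/-- Apply a function to the first entry of a list, if there is one. -/
def modifyFirst {α : Type*} (g : α → α) : List α → List α
  | [] => []
  | a :: l => g a :: l

/-- Apply a function to the last entry of a list, if there is one. -/
def modifyFinal {α : Type*} (g : α → α) : List α → List α
  | [] => []
  | [a] => [g a]
  | a :: b :: l => a :: modifyFinal g (b :: l)

theorem map_modifyFirst {α β : Type*} {g : α → α} {g' : β → β} {φ : α → β} {l : List α}
    (h : ∀ a ∈ l, φ (g a) = g' (φ a)) :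
    (modifyFirst g l).map φ = modifyFirst g' (l.map φ) := by
  cases l with
  | nil => rfl
  | cons a l => simp [modifyFirst, h a]

theorem map_modifyFinal {α β : Type*} {g : α → α} {g' : β → β} {φ : α → β} {l : List α}
    (h : ∀ a ∈ l, φ (g a) = g' (φ a)) :
    (modifyFinal g l).map φ = modifyFinal g' (l.map φ) := by
  induction l using modifyFinal.induct with
  | case1 => rfl
  | case2 a => simp [modifyFinal, h a]
  | case3 a b l ih =>
    have := ih fun c hc => h c (List.mem_cons_of_mem a hc)
    simpa [modifyFinal] using this

theorem exists_modifyFirst_succ {s : List ℕ} (h : 0 ∉ s) :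
    ∃ t, modifyFirst (· + 1) t = s ∧ t.length = s.length ∧
      (s = [] ∨ t.sum + 1 = s.sum) := by
  cases s with
  | nil => exact ⟨[], rfl, rfl, .inl rfl⟩
  | cons a s =>
    obtain ⟨a, rfl⟩ := Nat.exists_eq_succ_of_ne_zero fun e : a = 0 => h (by simp [e])
    exact ⟨a :: s, rfl, rfl, .inr (by simp; omega)⟩

theorem exists_modifyFinal_succ {s : List ℕ} (h : 0 ∉ s) :
    ∃ t, modifyFinal (· + 1) t = s ∧ t.length = s.length ∧
      (s = [] ∨ t.sum + 1 = s.sum) := by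
  rcases List.eq_nil_or_concat s with rfl | ⟨s, a, rfl⟩
  · exact ⟨[], rfl, rfl, .inl rfl⟩
  · obtain ⟨a, rfl⟩ := Nat.exists_eq_succ_of_ne_zero fun e : a = 0 => h (by simp [e])
    refine ⟨s ++ [a], ?_, by simp, .inr (by simp; omega)⟩
    clear h
    induction s with
    | nil => rfl
    | cons b s ih =>
      cases s with
      | nil => rfl
      | cons c s => simpa [modifyFinal] using ih

/-- A color `y` that is forced at a vertex is useless in the two neighboring lists. -/
theorem PathColorable.of_insert {y z p : ℕ} {A B : List (Finset ℕ)}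
    (h : PathColorable z p (modifyFinal (insert y) A ++ {y} :: modifyFirst (insert y) B)) :
    PathColorable z p A ∧ PathColorable z z B ∧ z ≠ y := by
  constructor
  · induction A using modifyFinal.induct generalizing p with
    | case1 => trivial
    | case2 L =>
      obtain ⟨q, hq, hz, hp, r, hr, -, hrq, -⟩ := h
      rw [Finset.mem_singleton] at hr
      exact ⟨q, Finset.mem_of_mem_insert_of_ne hq (by grind), hz, hp, trivial⟩
    | case3 L L' A ih =>
      obtain ⟨q, hq, hz, hp, h⟩ := h
      exact ⟨q, hq, hz, hp, ih h⟩
  · obtain ⟨r, hr, hz, -, h⟩ := h.right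
    rw [Finset.mem_singleton] at hr
    subst hr
    refine ⟨?_, hz.symm⟩
    cases B with
    | nil => trivial
    | cons L B =>
      obtain ⟨q, hq, hz, hp, h⟩ := h
      exact ⟨q, Finset.mem_of_mem_insert_of_ne hq hp, hz, hz, h⟩

/-- A list of size one inside the path: its color is blocked, and it can be added to the two
neighboring lists without effect. -/
theorem Blocks.one {s t : List ℕ} {m n : ℕ} (hs : Blocks s m) (ht : Blocks t n) :
    Blocks (modifyFinal (· + 1) s ++ 1 :: modifyFirst (· + 1) t) (m + n + 1) := by
  obtain ⟨A, hA, hA', S, hm, hS⟩ := hs.rename (φ := fun i => 2 * i + 1) fun i j h => by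
    simpa using h
  obtain ⟨B, hB, hB', T, hn, hT⟩ := ht.rename (φ := fun i => 2 * i + 2) fun i j h => by
    simpa using h
  have hA0 : ∀ L ∈ A, 0 ∉ L := by
    intro L hL h0
    obtain ⟨i, hi⟩ := hA' L hL 0 h0
    simp at hi
  have hB0 : ∀ L ∈ B, 0 ∉ L := by
    intro L hL h0
    obtain ⟨i, hi⟩ := hB' L hL 0 h0
    simp at hi
  refine ⟨modifyFinal (insert 0) A ++ {0} :: modifyFirst (insert 0) B, ?_, insert 0 (S ∪ T), ?_,
    fun z hz h => ?_⟩
  · rw [List.map_append, List.map_cons, ← hA, ← hB,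
      map_modifyFinal fun L hL => Finset.card_insert_of_notMem (hA0 L hL),
      map_modifyFirst fun L hL => Finset.card_insert_of_notMem (hB0 L hL)]
    simp
  · rw [Finset.card_insert_of_notMem, Finset.card_union_of_disjoint]
    · omega
    · rw [Finset.disjoint_left]
      intro z hz hz'
      obtain ⟨i, hi⟩ := (hS z hz).1
      obtain ⟨j, hj⟩ := (hT z hz').1
      simp only at hi hj
      omega
    · intro h0
      rcases Finset.mem_union.1 h0 with hz | hz
      · obtain ⟨i, hi⟩ := (hS 0 hz).1
        simp at hi
      · obtain ⟨i, hi⟩ := (hT 0 hz).1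
        simp at hi
  · obtain ⟨h1, h2, h3⟩ := h.of_insert
    rcases Finset.mem_insert.1 hz with hz | hz
    · exact h3 hz
    rcases Finset.mem_union.1 hz with hz | hz
    · exact (hS z hz).2 h1
    · exact (hT z hz).2 h2

/-! ### Lists of sizes two and three -/

/-- Lists of sizes two and three on a path, each with a set of colors whose removal makes the path
uncolorable. Every sequence of at most nine twos and threes is composed of the sequences of sizes
of these blocks, of their reverses, and of single vertices without blocked colors, so that the
number of blocked colors is large enough. -/
def blockTable : List (List (Finset ℕ) × Finset ℕ) := [
  ([{0, 1}, {0, 1}], {0, 1}),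
  ([{0, 1}, {0, 1, 2}, {0, 2}], {0}),
  ([{0, 1}, {0, 1, 2}, {0, 1, 2}, {0, 1}], {0, 1}),
  ([{0, 1}, {0, 1, 2}, {0, 2}, {0, 1, 2}, {1, 2}], {0, 1, 2}),
  ([{0, 1}, {0, 1, 2}, {0, 1, 2}, {0, 1, 2}, {0, 2}], {0}),
  ([{0, 1}, {0, 1, 2}, {2, 3}, {2, 3}, {0, 1, 2}, {0, 1}], {0, 1, 2, 3}),
  ([{0, 1}, {0, 1, 2}, {0, 1, 2}, {0, 1, 2}, {0, 1, 2}, {0, 1}], {0, 1}),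
  ([{0, 1}, {0, 1, 2}, {2, 3}, {2, 3}, {0, 2}, {0, 1, 2}, {1, 2}], {0, 1, 2, 3}),
  ([{0, 1}, {0, 1, 2}, {0, 2}, {0, 1, 2}, {0, 1, 2}, {0, 1, 2}, {1, 2}], {0, 1, 2}),
  ([{0, 1}, {0, 1, 2}, {0, 1, 2}, {0, 1, 2}, {0, 1, 2}, {0, 1, 2}, {0, 2}], {0}),
  ([{0, 1}, {0, 1, 2}, {2, 3}, {2, 3}, {2, 4}, {0, 4}, {0, 1, 4}, {1, 4}], {0, 1, 2, 3, 4}),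
  ([{0, 1}, {0, 1, 2}, {2, 3}, {2, 3}, {0, 1, 2}, {0, 1, 2}, {0, 1, 2}, {0, 1}], {0, 1, 2, 3}),
  ([{0, 1}, {0, 1, 2}, {0, 2}, {0, 1, 2}, {1, 2, 3}, {1, 3}, {1, 2, 3}, {2, 3}], {0, 1, 2, 3}),
  ([{0, 1}, {0, 1, 2}, {0, 1, 2}, {0, 1, 2}, {0, 1, 2}, {0, 1, 2}, {0, 1, 2}, {0, 1}], {0, 1}),
  ([{0, 1}, {0, 1, 2}, {2, 3}, {2, 3}, {2, 4}, {4, 5}, {4, 5}, {0, 1, 4}, {0, 1}],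
    {0, 1, 2, 3, 4, 5}),
  ([{0, 1}, {0, 1, 2}, {2, 3}, {2, 3}, {0, 2}, {0, 1, 2}, {0, 1, 2}, {0, 1, 2}, {1, 2}],
    {0, 1, 2, 3}),
  ([{0, 1}, {0, 1, 2}, {2, 3}, {2, 3}, {0, 1, 2}, {0, 1, 4}, {0, 4}, {0, 1, 4}, {1, 4}],
    {0, 1, 2, 3, 4}),
  ([{0, 1}, {0, 1, 2}, {0, 2}, {0, 1, 2}, {0, 1, 2}, {0, 1, 2}, {0, 1, 2}, {0, 1, 2}, {1, 2}],
    {0, 1, 2}),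
  ([{0, 1}, {0, 1, 2}, {0, 1, 2}, {0, 1, 2}, {0, 2}, {0, 1, 2}, {0, 1, 2}, {0, 1, 2}, {1, 2}],
    {0, 1, 2}),
  ([{0, 1}, {0, 1, 2}, {0, 1, 2}, {0, 1, 2}, {0, 1, 2}, {0, 1, 2}, {0, 1, 2}, {0, 1, 2},
    {0, 2}], {0})]

/-- The sizes of the lists of the blocks and their reverses, with the number of blocked colors. -/
def blockSizes : List (List ℕ × ℕ) :=
  blockTable.map (fun b => (b.1.map Finset.card, #b.2)) ++
    blockTable.map (fun b => (b.1.reverse.map Finset.card, #b.2))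

theorem blocks_of_mem_blockSizes {b : List ℕ × ℕ} (hb : b ∈ blockSizes) : Blocks b.1 b.2 := by
  have h : ∀ b ∈ blockTable, ∀ z ∈ b.2,
      ¬ PathColorable z z b.1 ∧ ¬ PathColorable z z b.1.reverse := by decide +kernel
  rcases List.mem_append.1 hb with hb | hb
  · obtain ⟨c, hc, rfl⟩ := List.mem_map.1 hb
    exact ⟨c.1, rfl, c.2, le_rfl, fun z hz => (h c hc z hz).1⟩
  · obtain ⟨c, hc, rfl⟩ := List.mem_map.1 hb
    exact ⟨c.1.reverse, rfl, c.2, le_rfl, fun z hz => (h c hc z hz).2⟩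

/-- The largest number of colors blocked by a composition of the sequence `s` of sizes out of blocks
and single vertices. The first argument bounds the number of parts. -/
def bestBlocks : ℕ → List ℕ → ℕ
  | 0, _ => 0
  | _ + 1, [] => 0
  | n + 1, a :: s => ((blockSizes.filter fun b => b.1.isPrefixOf (a :: s)).map
      fun b => b.2 + bestBlocks n ((a :: s).drop b.1.length)).foldr max (bestBlocks n s)

theorem blocks_bestBlocks (n : ℕ) (s : List ℕ) : Blocks s (bestBlocks n s) := by
  induction n generalizing s with
  | zero => exact blocks_zero s
  | succ n ih =>
    cases s with
    | nil => exact blocks_zero []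
    | cons a s =>
      have hfold : ∀ (l : List ℕ) (x : ℕ), Blocks (a :: s) x → (∀ y ∈ l, Blocks (a :: s) y) →
          Blocks (a :: s) (l.foldr max x) := by
        intro l x hx hl
        induction l with
        | nil => exact hx
        | cons y l ihl =>
          rw [List.foldr_cons]
          rcases max_choice y (l.foldr max x) with h | h <;> rw [h]
          · exact hl y (by simp)
          · exact ihl fun y hy => hl y (by simp [hy])
      refine hfold _ _ ?_ fun y hy => ?_
      · have := (blocks_zero [a]).append (ih s)
        rwa [Nat.zero_add] at this
      · obtain ⟨b, hb, rfl⟩ := List.mem_map.1 hy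
        obtain ⟨hb, hpre⟩ := List.mem_filter.1 hb
        obtain ⟨t, ht⟩ := List.isPrefixOf_iff_prefix.1 hpre
        rw [← ht, List.drop_left]
        exact (blocks_of_mem_blockSizes hb).append (ih t)

/-- The property `P` for all lists obtained from `s` by adding at most `n` twos and threes in
front. -/
def checkAll (P : List ℕ → Bool) : ℕ → List ℕ → Bool
  | 0, s => P s
  | n + 1, s => P s && checkAll P n (2 :: s) && checkAll P n (3 :: s)

theorem of_checkAll {P : List ℕ → Bool} {n : ℕ} {s t : List ℕ} (h : checkAll P n s = true)
    (ht : ∀ x ∈ t, x = 2 ∨ x = 3) (hn : t.length ≤ n) : P (t.reverseAux s) = true := by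
  induction n generalizing s t with
  | zero =>
    rw [List.length_eq_zero_iff.1 (Nat.le_zero.1 hn)]
    exact h
  | succ n ih =>
    simp only [checkAll, Bool.and_eq_true] at h
    cases t with
    | nil => exact h.1.1
    | cons a t =>
      have ht' : ∀ x ∈ t, x = 2 ∨ x = 3 := fun x hx => ht x (by simp [hx])
      have hn' : t.length ≤ n := by simpa using hn
      rcases ht a (by simp) with rfl | rfl
      · exact ih (s := 2 :: s) (t := t) h.1.2 ht' hn'
      · exact ih (s := 3 :: s) (t := t) h.2 ht' hn'

theorem exists_blocks_two_three {s : List ℕ} (hs : ∀ x ∈ s, x = 2 ∨ x = 3) (h9 : s.length ≤ 9) :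
    ∃ m, Blocks s m ∧ 3 * s.length ≤ s.sum + m + 1 := by
  have h : checkAll (fun s => decide (3 * s.length ≤ s.sum + bestBlocks s.length s + 1)) 9 []
      = true := by decide +kernel
  have := of_checkAll h (t := s.reverse) (by simpa using hs) (by simpa using h9)
  rw [List.reverseAux_eq, List.reverse_reverse, List.append_nil] at this
  exact ⟨_, blocks_bestBlocks s.length s, of_decide_eq_true this⟩

/-! ### Short fans -/

/-- The required number of blocked colors for arbitrary sizes, by induction on the length: a list of
size one or at least four splits the path into shorter ones. -/
theorem exists_blocks (s : List ℕ) (h9 : s.length ≤ 9) :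
    ∃ m, Blocks s m ∧ 3 * s.length ≤ s.sum + m + 1 := by
  induction hn : s.length using Nat.strong_induction_on generalizing s with
  | _ n ih =>
  subst hn
  by_cases h0 : 0 ∈ s
  · exact ⟨3 * s.length, blocks_of_zero_mem h0 _, by omega⟩
  by_cases h1 : 1 ∈ s
  · obtain ⟨A, B, rfl⟩ := List.append_of_mem h1
    simp only [List.mem_append, List.mem_cons, not_or] at h0
    obtain ⟨A', rfl, hA, hA'⟩ := exists_modifyFinal_succ h0.1
    obtain ⟨B', rfl, hB, hB'⟩ := exists_modifyFirst_succ h0.2.2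
    simp only [List.length_append, List.length_cons, ← hA, ← hB] at h9 ih ⊢
    obtain ⟨m, hm, hm'⟩ := ih A'.length (by omega) A' (by omega) rfl
    obtain ⟨n, hn, hn'⟩ := ih B'.length (by omega) B' (by omega) rfl
    refine ⟨m + n + 1, hm.one hn, ?_⟩
    simp only [List.sum_append, List.sum_cons]
    have ha : A'.length = 0 ∨ A'.sum + 1 = (modifyFinal (· + 1) A').sum :=
      hA'.imp_left fun e => by rw [hA, e]; rfl
    have hb : B'.length = 0 ∨ B'.sum + 1 = (modifyFirst (· + 1) B').sum :=
      hB'.imp_left fun e => by rw [hB, e]; rfl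
    have ha0 : A'.length = 0 → A'.sum = 0 := fun e => by rw [List.length_eq_zero_iff.1 e]; rfl
    have hb0 : B'.length = 0 → B'.sum = 0 := fun e => by rw [List.length_eq_zero_iff.1 e]; rfl
    omega
  by_cases h4 : ∃ x ∈ s, 4 ≤ x
  · obtain ⟨x, hx, h4⟩ := h4
    obtain ⟨A, B, rfl⟩ := List.append_of_mem hx
    simp only [List.length_append, List.length_cons] at h9 ih ⊢
    obtain ⟨m, hm, hm'⟩ := ih A.length (by omega) A (by omega) rfl
    obtain ⟨n, hn, hn'⟩ := ih B.length (by omega) B (by omega) rfl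
    refine ⟨m + (0 + n), hm.append ((blocks_zero [x]).append hn), ?_⟩
    simp only [List.sum_append, List.sum_cons]
    omega
  · push Not at h4
    refine exists_blocks_two_three (fun x hx => ?_) h9
    have := h4 x hx
    have h0' : x ≠ 0 := fun e => h0 (e ▸ hx)
    have h1' : x ≠ 1 := fun e => h1 (e ▸ hx)
    omega

/-- The hub needs more colors than the rim lists can block. -/
theorem lt_of_isChoiceFunction_brokenWheel {k : ℕ} {f : Fin (k + 1) → ℕ}
    (hf : IsChoiceFunction (brokenWheel k) f) {m : ℕ}
    (hm : Blocks (List.ofFn fun i : Fin k => f i.succ) m) : m < f 0 := by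
  obtain ⟨Ls, hs, S, hS, hbad⟩ := hm
  by_contra! hlt
  obtain ⟨T, hTS, hT⟩ := Finset.exists_subset_card_eq (hlt.trans hS)
  have hlen : Ls.length = k := by simpa using congrArg List.length hs
  obtain ⟨C, hC⟩ := hf (Fin.cons T fun i : Fin k => Ls[i.val]'(by omega)) (by
    intro v
    refine Fin.cases ?_ (fun i => ?_) v
    · simpa using hT
    · have hi : i.val < (Ls.map Finset.card).length := by simp [hlen]
      have : (Ls.map Finset.card)[i.val] = f i.succ := by
        simp only [hs, List.getElem_ofFn]
      simpa using this)
  have hz : C 0 ∈ S := hTS (by simpa using hC 0)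
  have hub : ∀ i (hi : i + 1 < k + 1), C ⟨i + 1, hi⟩ ≠ C 0 := by
    intro i hi
    refine (C.valid ((brokenWheel_adj (Fin.lt_def.2 ?_)).2 ?_)).symm <;> simp
  refine hbad _ hz (PathColorable.of_forall
    (c := fun i => if h : i + 1 < k + 1 then C ⟨i + 1, h⟩ else 0) ?_ ?_ ?_)
  · intro i hi
    have hi' : i + 1 < k + 1 := by omega
    simp only [hi', dite_true]
    exact ⟨hC ⟨i + 1, hi'⟩, hub i hi'⟩
  · intro i hi
    have hi' : i + 1 < k + 1 := by omega
    have hi'' : i + 1 + 1 < k + 1 := by omega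
    simp only [hi', hi'', dite_true]
    refine C.valid ((brokenWheel_adj (Fin.lt_def.2 ?_)).2 ?_) <;> simp
  · intro h
    have h1 : 0 + 1 < k + 1 := by omega
    simp only [h1, dite_true]
    exact hub 0 h1

theorem scGreedy_brokenWheel {k : ℕ} (hk : k ≤ 9) : ScGreedy (brokenWheel k) := by
  refine scGreedy_of_le fun f hf => ?_
  obtain ⟨m, hm, hle⟩ := exists_blocks (List.ofFn fun i : Fin k => f i.succ) (by simpa using hk)
  have := lt_of_isChoiceFunction_brokenWheel hf hm
  rw [List.length_ofFn, List.sum_ofFn] at hle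
  rw [greedyBound_brokenWheel, size, Fin.sum_univ_succ]
  omega

/-! ### Short wheels -/

theorem wheel_eq_brokenWheel {k : ℕ} (hk : k ≤ 2) : wheel k = brokenWheel k := by
  ext i j
  simp only [brokenWheel, wheel, SimpleGraph.fromRel_adj, ne_eq, Fin.ext_iff]
  omega

/-- In the complete graph on four vertices, the lists `{0, …, f v - 1}` show that a choice
function has size at least `1 + 2 + 3 + 4`. -/
theorem scGreedy_wheel_three : ScGreedy (wheel 3) := by
  refine scGreedy_of_le fun f hf => ?_
  obtain ⟨C, hC⟩ := hf (fun v => Finset.range (f v)) fun v => Finset.card_range _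
  have hadj : ∀ u v : Fin 4, u < v → C u ≠ C v := fun u v huv => C.valid <| by
    rw [wheel_adj huv]
    have : u.val < v.val := huv
    omega
  rw [greedyBound_wheel le_rfl, size, Fin.sum_univ_four]
  have h0 := Finset.mem_range.1 (hC 0)
  have h1 := Finset.mem_range.1 (hC 1)
  have h2 := Finset.mem_range.1 (hC 2)
  have h3 := Finset.mem_range.1 (hC 3)
  have h01 := hadj 0 1 (by decide)
  have h02 := hadj 0 2 (by decide)
  have h03 := hadj 0 3 (by decide)
  have h12 := hadj 1 2 (by decide)
  have h13 := hadj 1 3 (by decide)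
  have h23 := hadj 2 3 (by decide)
  omega

theorem scGreedy_wheel {k : ℕ} (hk : k ≤ 3) : ScGreedy (wheel k) := by
  rcases hk.lt_or_eq with h | rfl
  · rw [wheel_eq_brokenWheel (by omega)]
    exact scGreedy_brokenWheel (by omega)
  · exact scGreedy_wheel_three

end SumList

theorem mainTheorem5 :
    (∀ k : ℕ, k ≤ 9 → SumList.ScGreedy (SumList.brokenWheel k)) ∧
    (∀ k : ℕ, 10 ≤ k → ¬ SumList.ScGreedy (SumList.brokenWheel k)) ∧
    (∀ k : ℕ, k ≤ 3 → SumList.ScGreedy (SumList.wheel k)) ∧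
    (∀ k : ℕ, k = 4 ∨ 11 ≤ k → ¬ SumList.ScGreedy (SumList.wheel k)) := by
  refine ⟨fun k hk => SumList.scGreedy_brokenWheel hk,
    fun k hk => SumList.not_scGreedy_brokenWheel hk, fun k hk => SumList.scGreedy_wheel hk, ?_⟩
  rintro k (rfl | hk)
  · exact SumList.not_scGreedy_wheel_four
  · exact SumList.not_scGreedy_wheel hk
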